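/- **Setting.** Let $f:\mathbb R^n\to\mathbb R$ and $c:\mathbb R^n\to\mathbb R^m$ be $\mathcal C^1$, $J$ the Jacobian of $c$, and $f\ge f_{\rm low}$ on $\mathbb R^n$; norms are Euclidean. For $\sigma,\tau>0$ let $s_{\rm cp}(x;\sigma,\tau)$ be the minimizer over $s$ of $f(x)+\nabla f(x)^Ts+\tau\|c(x)+J(x)s\|+\tfrac12\sigma\|s\|^2$, and $$\xi(x;\sigma,\tau)=f(x)+\tau\|c(x)\|-\bigl(f(x)+\nabla f(x)^Ts_{\rm cp}+\tau\|c(x)+J(x)s_{\rm cp}\|\bigr).$$ Let $\theta(x)=\|c(x)\|-\|c(x)+J(x)s^*\|$, where $s^*$ minimizes $\tfrac12\|s\|^2+\|c(x)+J(x)s\|$. **Algorithm.** Parameters: $0<\eta_1\le\eta_2<1$, $0<\gamma_3\le1<\gamma_1\le\gamma_2$, $\beta_1,\beta_3,\beta_4,\tau_0,\epsilon_0>0$, $0<\beta_2<1$, and a starting point $x_0$. For $k=0,1,\dots$: put $x_{k,0}=x_k$, $\sigma_{k,0}=\max(\beta_3\tau_k,\beta_4)$ and apply R2 to $F_k=f+\tau_k\|c\|$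 until the first $j=j_k$ with $\sigma_{k,j}^{1/2}\xi(x_{k,j};\sigma_{k,j},\tau_k)^{1/2}\le\epsilon_k$; then $x_{k+1}=x_{k,j_k}$. In one R2 iteration, with $s=s_{\rm cp}(x_{k,j};\sigma_{k,j},\tau_k)$ and $\rho=(F_k(x_{k,j})-F_k(x_{k,j}+s))/\xi(x_{k,j};\sigma_{k,j},\tau_k)$, put $x_{k,j+1}=x_{k,j}+s$ if $\rho\ge\eta_1$ and $x_{k,j+1}=x_{k,j}$ otherwise, and choose $\sigma_{k,j+1}$ in $[\max(\gamma_3\sigma_{k,j},\beta_4),\sigma_{k,j}]$ if $\rho\ge\eta_2$, in $[\sigma_{k,j},\gamma_1\sigma_{k,j}]$ if $\eta_1\le\rho<\eta_2$, in $[\gamma_1\sigma_{k,j},\gamma_2\sigma_{k,j}]$ if $\rho<\eta_1$. If $\theta(x_{k+1})^{1/2}>\epsilon_k$, choose any $\tau_{k+1}\ge\tau_k+\beta_1$ and put $\epsilon_{k+1}=\epsilon_k$; otherwise $\tau_{k+1}=\tau_k$, $\epsilon_{k+1}=\beta_2\epsilon_k$. **Assumption.** There are constants $\kappa_{m_1},\kappa_{m_2}>0$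 and $\kappa_{m,k}>0$ with $\kappa_{m,k}\le\kappa_{m_1}\tau_k+\kappa_{m_2}$ such that in every inner iteration performed in outer iteration $k$, $$\bigl|F_k(x_{k,j}+s)-\bigl(f(x_{k,j})+\nabla f(x_{k,j})^Ts+\tau_k\|c(x_{k,j})+J(x_{k,j})s\|\bigr)\bigr|\le\kappa_{m,k}\|s\|^2,\qquad s=s_{\rm cp}(x_{k,j};\sigma_{k,j},\tau_k).$$ **Notation.** For $0<\epsilon\le\epsilon_0$ let $k(\epsilon)$ be the least $k\ge0$ with $\theta(x_k)^{1/2}\le\epsilon$, and $K(\epsilon)$ the least $k\ge1$ with $\theta(x_k)^{1/2}\le\epsilon$ and $\epsilon_{k-1}\le\epsilon$. Let $\alpha_1=(1+|\log_{\gamma_1}\gamma_3|)/\eta_1$, $\alpha_2=|1/\log\gamma_1|$, $\alpha_3=2\gamma_2/(1-\eta_2)$, $\alpha_4=\max(\beta_3,\alpha_3\kappa_{m_1})$, $\alpha_5=\max(\beta_4,\alpha_3\kappa_{m_2})$. For an index $K$ and $t\ge0$ let $\kappa_h=\max_{k<K}\|c(x_k)\|$, $\kappa_f=\max_{k<K}f(x_k)-f_{\rm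 low}$ (both $0$ if $K=0$), $\hat\tau=\max(t,\max_{k<K}\tau_k)$, and, with $\lceil a\rceil_+=\max(\lceil a\rceil,0)$, $$B(t,\epsilon,K)=\Bigl(\Bigl\lceil\tfrac{t-\tau_0}{\beta_1}\Bigr\rceil_++\bigl\lceil\log_{\beta_2}(\epsilon/\epsilon_0)\bigr\rceil+1\Bigr)\Bigl(\frac{\alpha_1(\kappa_h\hat\tau+\kappa_f)(\alpha_4\hat\tau+\alpha_5)}{(\beta_2\epsilon)^2}+\alpha_2\Bigl|\log\frac{\alpha_4\tau_0+\alpha_5}{\beta_3\tau_0}\Bigr|\Bigr).$$ Say that the algorithm *terminates at a critical point* if every inner loop stops, $k(\epsilon)$ and $K(\epsilon)$ exist, and $x_K$ with $K=K(\epsilon)$ is either an approximate KKT point ($\|c(x_K)\|\le\epsilon$ and $\|\nabla f(x_K)-J(x_K)^T\bar y\|\le\epsilon$ for some $\bar y\in\mathbb R^m$) or an approximate infeasible critical point of the feasibility measure ($\|c(x_K)\|>\epsilon$ and $\theta(x_K)^{1/2}\le\epsilon$), the same being true for $K=k(\epsilon)\ge1$ with $\epsilon_{K-1}$ as the tolerance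 on $\|\nabla f(x_K)-J(x_K)^T\bar y\|$. **Theorem.** (i) Let $0<\epsilon\le\epsilon_0$ and suppose that $\bar\tau\ge0$ is such that $\theta(x_{k+1})^{1/2}<\epsilon$ whenever $\tau_k\ge\bar\tau$. Then the algorithm terminates at a critical point, and for $K=k(\epsilon)$ and for $K=K(\epsilon)$ the total number of inner iterations satisfies $\sum_{k<K}j_k\le B(\bar\tau,\epsilon,K)$. Moreover, for every $\Lambda$ there is a constant $C>0$, depending on $f$, $c$, $f_{\rm low}$, $x_0$, $\kappa_{m_1}$, $\kappa_{m_2}$, $\Lambda$ and the parameters of the algorithm but not on $\epsilon$, $\bar\tau$ or the run, such that if $\tau_{k+1}\le\Lambda\tau_k$ for all $k$ and $\bar\tau\ge\tau_0$, then $\sum_{k<K}j_k\le C\,(\bar\tau+|\log(\epsilon/\epsilon_0)|)\,\bar\tau^2\epsilon^{-2}$ for both values of $K$. (ii) Suppose instead that $\|\nabla f(x_k)\|\le\kappa_g$ for all $k$, with $\kappa_g\ge0$ (in particular, $\tau_k$ may grow unboundedly). Then for every $0<\epsilon\le\epsilon_0$ the algorithm terminates at a critical point, and there is $\bar\epsilon>0$,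 independent of $\epsilon$ and of the run, such that if $\epsilon\le\bar\epsilon$, then $\sum_{k<K}j_k\le B((\kappa_g+1)\epsilon^{-2}+1,\epsilon,K)$ for $K=k(\epsilon)$ and $K=K(\epsilon)$. Moreover, for every $\Lambda$ there is $C>0$, depending on the same data as in (i) and on $\kappa_g$ but not on $\epsilon$ or the run, such that if $\tau_{k+1}\le\Lambda\tau_k$ for all $k$, then $\sum_{k<K}j_k\le C\epsilon^{-8}$ for both values of $K$. -/

import Mathlib

open scoped InnerProductSpace

noncomputable section

namespace ExactPenalty

variable {n m : ℕ}

/-- The objective `F_τ = f + τ ‖c(·)‖₂` of the penalized problem. -/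
def penalized (f : EuclideanSpace ℝ (Fin n) → ℝ)
    (c : EuclideanSpace ℝ (Fin n) → EuclideanSpace ℝ (Fin m)) (τ : ℝ)
    (x : EuclideanSpace ℝ (Fin n)) : ℝ :=
  f x + τ * ‖c x‖

/-- The linear model `φ(s; x) = f(x) + ∇f(x)ᵀ s`. -/
def phi (f : EuclideanSpace ℝ (Fin n) → ℝ) (s x : EuclideanSpace ℝ (Fin n)) : ℝ :=
  f x + ⟪gradient f x, s⟫_ℝ

/-- The model `ψ_τ(s; x) = τ ‖c(x) + J(x) s‖₂`. -/
def psi (c : EuclideanSpace ℝ (Fin n) → EuclideanSpace ℝ (Fin m)) (τ : ℝ)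
    (s x : EuclideanSpace ℝ (Fin n)) : ℝ :=
  τ * ‖c x + fderiv ℝ c x s‖

/-- `s` minimizes `φ(·; x) + ψ_τ(·; x) + ½ σ ‖·‖²`. -/
def IsCauchyPoint (f : EuclideanSpace ℝ (Fin n) → ℝ)
    (c : EuclideanSpace ℝ (Fin n) → EuclideanSpace ℝ (Fin m)) (σ τ : ℝ)
    (x s : EuclideanSpace ℝ (Fin n)) : Prop :=
  ∀ u, phi f s x + psi c τ s x + 1 / 2 * σ * ‖s‖ ^ 2
    ≤ phi f u x + psi c τ u x + 1 / 2 * σ * ‖u‖ ^ 2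

/-- The step is well defined: the regularized model has exactly one minimizer. -/
theorem existsUnique_isCauchyPoint (f : EuclideanSpace ℝ (Fin n) → ℝ)
    (c : EuclideanSpace ℝ (Fin n) → EuclideanSpace ℝ (Fin m)) {σ τ : ℝ}
    (hσ : 0 < σ) (hτ : 0 ≤ τ) (x : EuclideanSpace ℝ (Fin n)) :
    ∃! s, IsCauchyPoint f c σ τ x s := by
  have hex : ∃ s, IsCauchyPoint f c σ τ x s := by
    unfold IsCauchyPoint
    apply Continuous.exists_forall_le
    · unfold phi psi
      fun_prop
    · have hq : Filter.Tendsto (fun r : ℝ => f x + r * (1 / 2 * σ * r + -‖gradient f x‖))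
          Filter.atTop Filter.atTop := by
        apply Filter.tendsto_atTop_add_const_left
        apply Filter.Tendsto.atTop_mul_atTop₀ Filter.tendsto_id
        apply Filter.tendsto_atTop_add_const_right
        exact Filter.Tendsto.const_mul_atTop (by positivity) Filter.tendsto_id
      refine Filter.tendsto_atTop_mono ?_
        (hq.comp (tendsto_norm_cocompact_atTop (E := EuclideanSpace ℝ (Fin n))))
      intro u
      have h1 : -(‖gradient f x‖ * ‖u‖) ≤ ⟪gradient f x, u⟫_ℝ :=
        (abs_le.mp (abs_real_inner_le_norm _ _)).1
      have h2 : 0 ≤ τ * ‖c x + fderiv ℝ c x u‖ := by positivity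
      simp only [Function.comp, phi, psi]
      nlinarith
  obtain ⟨s, hs⟩ := hex
  refine ⟨s, hs, fun t ht => ?_⟩
  set w : EuclideanSpace ℝ (Fin n) := (1 / 2 : ℝ) • (s + t) with hw
  have h1 := hs w
  have h2 := ht w
  have hin : ⟪gradient f x, w⟫_ℝ
      = 1 / 2 * (⟪gradient f x, s⟫_ℝ + ⟪gradient f x, t⟫_ℝ) := by
    rw [hw, inner_smul_right, inner_add_right]
  have hps : ‖c x + fderiv ℝ c x w‖
      ≤ 1 / 2 * (‖c x + fderiv ℝ c x s‖ + ‖c x + fderiv ℝ c x t‖) := by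
    have e : c x + fderiv ℝ c x w
        = (1 / 2 : ℝ) • ((c x + fderiv ℝ c x s) + (c x + fderiv ℝ c x t)) := by
      rw [hw, map_smul, map_add]
      module
    rw [e, norm_smul, Real.norm_of_nonneg (by norm_num : (0 : ℝ) ≤ 1 / 2)]
    exact mul_le_mul_of_nonneg_left (norm_add_le _ _) (by norm_num)
  have hnw : ‖w‖ ^ 2 = 1 / 4 * ‖s + t‖ ^ 2 := by
    rw [hw, norm_smul, Real.norm_of_nonneg (by norm_num : (0 : ℝ) ≤ 1 / 2)]
    ring
  have hpar := parallelogram_law_with_norm ℝ s t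
  have hτps := mul_le_mul_of_nonneg_left hps hτ
  simp only [phi, psi] at h1 h2
  rw [hin, hnw] at h1 h2
  have hz : σ * ‖s - t‖ ^ 2 ≤ 0 := by
    have e : ‖s - t‖ ^ 2 = 2 * (‖s‖ ^ 2 + ‖t‖ ^ 2) - ‖s + t‖ ^ 2 := by nlinarith
    rw [e]
    nlinarith
  have h0 : ‖s - t‖ ^ 2 ≤ 0 := by
    by_contra hcon
    push Not at hcon
    nlinarith [mul_pos hσ hcon]
  have h00 : ‖s - t‖ = 0 := by
    have := sq_nonneg ‖s - t‖
    exact pow_eq_zero_iff (two_ne_zero) |>.mp (le_antisymm h0 this)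
  exact (sub_eq_zero.mp (norm_eq_zero.mp h00)).symm

/-- The step `s_cp`: the minimizer of `φ(·; x) + ψ_τ(·; x) + ½ σ ‖·‖²`. -/
def cauchyPoint (f : EuclideanSpace ℝ (Fin n) → ℝ)
    (c : EuclideanSpace ℝ (Fin n) → EuclideanSpace ℝ (Fin m)) (σ τ : ℝ)
    (x : EuclideanSpace ℝ (Fin n)) : EuclideanSpace ℝ (Fin n) :=
  Classical.epsilon (IsCauchyPoint f c σ τ x)

theorem cauchyPoint_spec (f : EuclideanSpace ℝ (Fin n) → ℝ)
    (c : EuclideanSpace ℝ (Fin n) → EuclideanSpace ℝ (Fin m)) {σ τ : ℝ}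
    (hσ : 0 < σ) (hτ : 0 ≤ τ) (x : EuclideanSpace ℝ (Fin n)) :
    IsCauchyPoint f c σ τ x (cauchyPoint f c σ τ x) :=
  Classical.epsilon_spec (existsUnique_isCauchyPoint f c hσ hτ x).exists

/-- `ξ(x; σ, τ) = f(x) + τ ‖c(x)‖ - (φ + ψ_τ)(s_cp; x)`. -/
def xi (f : EuclideanSpace ℝ (Fin n) → ℝ)
    (c : EuclideanSpace ℝ (Fin n) → EuclideanSpace ℝ (Fin m)) (σ τ : ℝ)
    (x : EuclideanSpace ℝ (Fin n)) : ℝ :=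
  penalized f c τ x
    - (phi f (cauchyPoint f c σ τ x) x + psi c τ (cauchyPoint f c σ τ x) x)

/-- The stationarity measure `σ^{1/2} ξ(x; σ, τ)^{1/2}`. -/
def statMeasure (f : EuclideanSpace ℝ (Fin n) → ℝ)
    (c : EuclideanSpace ℝ (Fin n) → EuclideanSpace ℝ (Fin m)) (σ τ : ℝ)
    (x : EuclideanSpace ℝ (Fin n)) : ℝ :=
  √σ * √(xi f c σ τ x)

/-- The minimizer `s*` of `½ ‖s‖² + ‖c(x) + J(x) s‖`, i.e. the step for `f = 0`, `σ = τ = 1`. -/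
def feasStep (c : EuclideanSpace ℝ (Fin n) → EuclideanSpace ℝ (Fin m))
    (x : EuclideanSpace ℝ (Fin n)) : EuclideanSpace ℝ (Fin n) :=
  cauchyPoint (fun _ => 0) c 1 1 x

theorem feasStep_spec (c : EuclideanSpace ℝ (Fin n) → EuclideanSpace ℝ (Fin m))
    (x u : EuclideanSpace ℝ (Fin n)) :
    1 / 2 * ‖feasStep c x‖ ^ 2 + ‖c x + fderiv ℝ c x (feasStep c x)‖
      ≤ 1 / 2 * ‖u‖ ^ 2 + ‖c x + fderiv ℝ c x u‖ := by
  have h := cauchyPoint_spec (fun _ => 0) c one_pos zero_le_one x u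
  have hg : gradient (fun _ : EuclideanSpace ℝ (Fin n) => (0 : ℝ)) x = 0 :=
    gradient_fun_const x 0
  simp only [phi, psi, hg, inner_zero_left] at h
  simp only [feasStep]
  linarith

/-- `θ(x) = ‖c(x)‖ - ‖c(x) + J(x) s*‖`; the feasibility measure is `θ(x)^{1/2}`. -/
def theta (c : EuclideanSpace ℝ (Fin n) → EuclideanSpace ℝ (Fin m))
    (x : EuclideanSpace ℝ (Fin n)) : ℝ :=
  ‖c x‖ - ‖c x + fderiv ℝ c x (feasStep c x)‖

/-- Parameters of the method: `η₁, η₂, γ₁, γ₂, γ₃` belong to the inner solver R2, the others to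
the outer loop. -/
structure Params where
  η₁ : ℝ
  η₂ : ℝ
  γ₁ : ℝ
  γ₂ : ℝ
  γ₃ : ℝ
  β₁ : ℝ
  β₂ : ℝ
  β₃ : ℝ
  β₄ : ℝ
  τ₀ : ℝ
  ε₀ : ℝ
  η₁_pos : 0 < η₁
  η₁_le_η₂ : η₁ ≤ η₂
  η₂_lt_one : η₂ < 1
  γ₃_pos : 0 < γ₃
  γ₃_le_one : γ₃ ≤ 1
  one_lt_γ₁ : 1 < γ₁
  γ₁_le_γ₂ : γ₁ ≤ γ₂
  β₁_pos : 0 < β₁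
  β₂_pos : 0 < β₂
  β₂_lt_one : β₂ < 1
  β₃_pos : 0 < β₃
  β₄_pos : 0 < β₄
  τ₀_pos : 0 < τ₀
  ε₀_pos : 0 < ε₀

/-- The ratio of actual to predicted decrease of the step `s_cp`. -/
def rho (f : EuclideanSpace ℝ (Fin n) → ℝ)
    (c : EuclideanSpace ℝ (Fin n) → EuclideanSpace ℝ (Fin m)) (σ τ : ℝ)
    (x : EuclideanSpace ℝ (Fin n)) : ℝ :=
  (penalized f c τ x - penalized f c τ (x + cauchyPoint f c σ τ x)) / xi f c σ τ x

/-- One iteration `(x, σ) ↦ (x', σ')` of R2 on `f + τ ‖c‖`, with minimal regularization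
parameter `σmin`: the step is accepted if `ρ ≥ η₁`, and `σ` is updated according to `ρ`. -/
def R2Step (P : Params) (f : EuclideanSpace ℝ (Fin n) → ℝ)
    (c : EuclideanSpace ℝ (Fin n) → EuclideanSpace ℝ (Fin m)) (τ σmin : ℝ)
    (x : EuclideanSpace ℝ (Fin n)) (σ : ℝ) (x' : EuclideanSpace ℝ (Fin n)) (σ' : ℝ) : Prop :=
  (P.η₁ ≤ rho f c σ τ x → x' = x + cauchyPoint f c σ τ x) ∧
  (rho f c σ τ x < P.η₁ → x' = x) ∧
  (P.η₂ ≤ rho f c σ τ x → σ' ∈ Set.Icc (max (P.γ₃ * σ) σmin) σ) ∧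
  (P.η₁ ≤ rho f c σ τ x → rho f c σ τ x < P.η₂ → σ' ∈ Set.Icc σ (P.γ₁ * σ)) ∧
  (rho f c σ τ x < P.η₁ → σ' ∈ Set.Icc (P.γ₁ * σ) (P.γ₂ * σ))

/-- The quantities generated by the method: inner iterates `x k j = x_{k,j}`, regularization
parameters `σ k j = σ_{k,j}`, penalty parameters `τ k = τ_k`, inner tolerances `tol k = ε_k`.
The outer iterate `x_k` is `x k 0`. -/
structure Trace (n : ℕ) where
  x : ℕ → ℕ → EuclideanSpace ℝ (Fin n)
  σ : ℕ → ℕ → ℝ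
  τ : ℕ → ℝ
  tol : ℕ → ℝ

namespace Trace

/-- The inner stopping test of outer iteration `k` holds at `x_{k,j}`. -/
def InnerStop (R : Trace n) (f : EuclideanSpace ℝ (Fin n) → ℝ)
    (c : EuclideanSpace ℝ (Fin n) → EuclideanSpace ℝ (Fin m)) (k j : ℕ) : Prop :=
  statMeasure f c (R.σ k j) (R.τ k) (R.x k j) ≤ R.tol k

/-- `j_k(ε_k)`: the number of inner iterations in outer iteration `k`. -/
def innerCount (R : Trace n) (f : EuclideanSpace ℝ (Fin n) → ℝ)
    (c : EuclideanSpace ℝ (Fin n) → EuclideanSpace ℝ (Fin m)) (k : ℕ) : ℕ :=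
  sInf {j | R.InnerStop f c k j}

/-- Total number of inner iterations in the outer iterations `0, …, K - 1`. -/
def totalInner (R : Trace n) (f : EuclideanSpace ℝ (Fin n) → ℝ)
    (c : EuclideanSpace ℝ (Fin n) → EuclideanSpace ℝ (Fin m)) (K : ℕ) : ℕ :=
  ∑ k ∈ Finset.range K, R.innerCount f c k

end Trace

/-- `R` is a run of the exact penalty algorithm, with R2 as inner solver, started at `x₀`.
Inner iterations are performed as long as the inner test has not been satisfied. That the test is
eventually satisfied is not part of the definition: nothing links outer iteration `k + 1` to
outer iteration `k` if the inner loop of the latter does not stop. -/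
structure IsRun (P : Params) (f : EuclideanSpace ℝ (Fin n) → ℝ)
    (c : EuclideanSpace ℝ (Fin n) → EuclideanSpace ℝ (Fin m))
    (x₀ : EuclideanSpace ℝ (Fin n)) (R : Trace n) : Prop where
  x_init : R.x 0 0 = x₀
  τ_init : R.τ 0 = P.τ₀
  tol_init : R.tol 0 = P.ε₀
  σ_init : ∀ k, R.σ k 0 = max (P.β₃ * R.τ k) P.β₄
  inner : ∀ k j, (∀ i ≤ j, ¬ R.InnerStop f c k i) →
    R2Step P f c (R.τ k) P.β₄ (R.x k j) (R.σ k j) (R.x k (j + 1)) (R.σ k (j + 1))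
  outer_x : ∀ k j, IsLeast {i | R.InnerStop f c k i} j → R.x (k + 1) 0 = R.x k j
  outer_increase : ∀ k, (∃ j, R.InnerStop f c k j) → R.tol k < √(theta c (R.x (k + 1) 0)) →
    R.τ k + P.β₁ ≤ R.τ (k + 1) ∧ R.tol (k + 1) = R.tol k
  outer_keep : ∀ k, (∃ j, R.InnerStop f c k j) → √(theta c (R.x (k + 1) 0)) ≤ R.tol k →
    R.τ (k + 1) = R.τ k ∧ R.tol (k + 1) = P.β₂ * R.tol k

/-- The model-accuracy assumption: in every inner iteration performed within outer iteration `k`,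
the model error at the step is at most `κ_{m,k} ‖s_cp‖²`, and
`κ_{m,k} ≤ κ_{m₁} τ_k + κ_{m₂}`. -/
def ModelAccuracy (f : EuclideanSpace ℝ (Fin n) → ℝ)
    (c : EuclideanSpace ℝ (Fin n) → EuclideanSpace ℝ (Fin m)) (R : Trace n)
    (κm₁ κm₂ : ℝ) : Prop :=
  ∃ κm : ℕ → ℝ, (∀ k, 0 < κm k) ∧
    (∀ k j, (∀ i ≤ j, ¬ R.InnerStop f c k i) →
      |penalized f c (R.τ k) (R.x k j + cauchyPoint f c (R.σ k j) (R.τ k) (R.x k j))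
        - (phi f (cauchyPoint f c (R.σ k j) (R.τ k) (R.x k j)) (R.x k j)
          + psi c (R.τ k) (cauchyPoint f c (R.σ k j) (R.τ k) (R.x k j)) (R.x k j))|
        ≤ κm k * ‖cauchyPoint f c (R.σ k j) (R.τ k) (R.x k j)‖ ^ 2) ∧
    (∀ k, κm k ≤ κm₁ * R.τ k + κm₂)

/-- Approximate KKT point, with stationarity tolerance `δ` and feasibility tolerance `ε`. -/
def IsApproxKKT (f : EuclideanSpace ℝ (Fin n) → ℝ)
    (c : EuclideanSpace ℝ (Fin n) → EuclideanSpace ℝ (Fin m)) (δ ε : ℝ)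
    (x : EuclideanSpace ℝ (Fin n)) : Prop :=
  (∃ y : EuclideanSpace ℝ (Fin m),
    ‖gradient f x - ContinuousLinearMap.adjoint (fderiv ℝ c x) y‖ ≤ δ) ∧ ‖c x‖ ≤ ε

/-- Approximate infeasible critical point of the feasibility measure, with tolerance `ε`. -/
def IsApproxInfeasibleCritical
    (c : EuclideanSpace ℝ (Fin n) → EuclideanSpace ℝ (Fin m)) (ε : ℝ)
    (x : EuclideanSpace ℝ (Fin n)) : Prop :=
  ε < ‖c x‖ ∧ √(theta c x) ≤ ε

/-- `k(ε)`, the first index at which the outer stopping test `θ(x_k)^{1/2} ≤ ε` holds. -/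
def IsFeasIndex (c : EuclideanSpace ℝ (Fin n) → EuclideanSpace ℝ (Fin m)) (R : Trace n)
    (ε : ℝ) (K : ℕ) : Prop :=
  IsLeast {k | √(theta c (R.x k 0)) ≤ ε} K

/-- `K(ε)`, the first index `k ≥ 1` at which the test `θ(x_k)^{1/2} ≤ ε` holds at a point that
was computed with inner tolerance `ε_{k-1} ≤ ε`. -/
def IsStopIndex (c : EuclideanSpace ℝ (Fin n) → EuclideanSpace ℝ (Fin m)) (R : Trace n)
    (ε : ℝ) (K : ℕ) : Prop :=
  IsLeast {k | 0 < k ∧ R.tol (k - 1) ≤ ε ∧ √(theta c (R.x k 0)) ≤ ε} K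

/-- The algorithm terminates with an approximate KKT point or an infeasible critical point:
all inner loops stop, and both stopping indices exist. At `k(ε)`, if it is not `0`, the
stationarity tolerance is the inner tolerance in force; at `K(ε)`, it is `ε`. -/
def TerminatesAtCritical (f : EuclideanSpace ℝ (Fin n) → ℝ)
    (c : EuclideanSpace ℝ (Fin n) → EuclideanSpace ℝ (Fin m)) (R : Trace n) (ε : ℝ) : Prop :=
  (∀ k, ∃ j, R.InnerStop f c k j) ∧
  (∃ K, IsFeasIndex c R ε K ∧
    (0 < K → IsApproxKKT f c (R.tol (K - 1)) ε (R.x K 0)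
      ∨ IsApproxInfeasibleCritical c ε (R.x K 0))) ∧
  (∃ K, IsStopIndex c R ε K ∧
    (IsApproxKKT f c ε ε (R.x K 0) ∨ IsApproxInfeasibleCritical c ε (R.x K 0)))

/-- `κ_h = max_{k < K} ‖c(x_k)‖` (and `0` if `K = 0`). -/
def kappaH (c : EuclideanSpace ℝ (Fin n) → EuclideanSpace ℝ (Fin m)) (R : Trace n)
    (K : ℕ) : ℝ :=
  ⨆ k : Fin K, ‖c (R.x k 0)‖

/-- `κ_f = max_{k < K} f(x_k) - f_low` (and `0` if `K = 0`). -/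
def kappaF (f : EuclideanSpace ℝ (Fin n) → ℝ) (flow : ℝ) (R : Trace n) (K : ℕ) : ℝ :=
  ⨆ k : Fin K, (f (R.x k 0) - flow)

/-- The larger of `t` and of the penalty parameters used in outer iterations `k < K`. -/
def tauHat (R : Trace n) (t : ℝ) (K : ℕ) : ℝ :=
  max t (⨆ k : Fin K, R.τ k)

namespace Params

def α₁ (P : Params) : ℝ := (1 + |Real.logb P.γ₁ P.γ₃|) / P.η₁

def α₂ (P : Params) : ℝ := |1 / Real.log P.γ₁|

def α₃ (P : Params) : ℝ := 2 * P.γ₂ / (1 - P.η₂)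

def α₄ (P : Params) (κm₁ : ℝ) : ℝ := max P.β₃ (P.α₃ * κm₁)

def α₅ (P : Params) (κm₂ : ℝ) : ℝ := max P.β₄ (P.α₃ * κm₂)

end Params

/-- The explicit bound on the total number of inner iterations in outer iterations `k < K`,
for the threshold `t` on the penalty parameter and the tolerance `ε`. -/
def complexityBound (P : Params) (f : EuclideanSpace ℝ (Fin n) → ℝ)
    (c : EuclideanSpace ℝ (Fin n) → EuclideanSpace ℝ (Fin m)) (flow κm₁ κm₂ : ℝ)
    (R : Trace n) (t ε : ℝ) (K : ℕ) : ℝ :=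
  ((⌈(t - P.τ₀) / P.β₁⌉₊ : ℝ) + (⌈Real.logb P.β₂ (ε / P.ε₀)⌉₊ : ℝ) + 1) *
    (P.α₁ * (kappaH c R K * tauHat R t K + kappaF f flow R K)
        * (P.α₄ κm₁ * tauHat R t K + P.α₅ κm₂) / (P.β₂ * ε) ^ 2
      + P.α₂ * |Real.log ((P.α₄ κm₁ * P.τ₀ + P.α₅ κm₂) / (P.β₃ * P.τ₀))|)

end ExactPenalty

end

/-! The engine is the variational inequality `cauchyPoint_variational`. Tested at `0` it gives
`σ‖s‖² ≤ ξ`, along the kernel of `J` it yields a multiplier with residual `-σ s`, and at the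
feasibility step it gives `τ θ ≤ ξ + (‖∇f‖ + σ^{1/2} ξ^{1/2}) θ^{1/2}` (`mul_theta_le`).

Inner loop: the model error is `O(‖s‖²)`, hence small against `ξ` once `σ` is large, so `σ` stays
below `α₄ τ + α₅`. Every accepted step then lowers `F_k` by a fixed amount, while rejected steps are
paid for by the growth of `log σ` (`inner_count_le`).

Outer loop: each iteration either raises `τ` by at least `β₁` or multiplies the tolerance by `β₂`.
Before stopping, a cut needs a tolerance above `ε`, and a rise needs `τ` below a threshold `t`
(`IncreasesBelow`). This bounds the number of outer iterations and keeps tolerances at least `β₂ ε`;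
the product with the inner count is the bound. In the first case `t = τbar`; with bounded gradients
`mul_theta_le` gives `t = O(1/ε)`, eventually below `(κg + 1) ε⁻² + 1`.

The orders need no a priori bound on `f` or `c` at the iterates: the gap divided by `τ` never
increases (`penalized_sub_le`). -/

open scoped InnerProductSpace

namespace ExactPenalty

variable {n m : ℕ}

/-! ### Optimality conditions for one regularized step. -/

section Step

variable (f : EuclideanSpace ℝ (Fin n) → ℝ)
  (c : EuclideanSpace ℝ (Fin n) → EuclideanSpace ℝ (Fin m)) {σ τ : ℝ}

/-- The variational inequality characterizing `s_cp`. -/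
theorem cauchyPoint_variational (hσ : 0 < σ) (hτ : 0 ≤ τ) (x u : EuclideanSpace ℝ (Fin n)) :
    psi c τ (cauchyPoint f c σ τ x) x - psi c τ u x
      ≤ ⟪gradient f x + σ • cauchyPoint f c σ τ x, u - cauchyPoint f c σ τ x⟫_ℝ := by
  have hs := cauchyPoint_spec f c hσ hτ x
  set s := cauchyPoint f c σ τ x
  set d := u - s with hd
  -- Minimality against a point of the segment from `s` to `u`; the quadratic remainder vanishes as
  -- `t → 0`.
  have key : ∀ t : ℝ, 0 < t → t ≤ 1 →
      psi c τ s x - psi c τ u x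
        ≤ ⟪gradient f x + σ • s, d⟫_ℝ + t * (1 / 2 * σ * ‖d‖ ^ 2) := by
    intro t ht ht1
    have h := hs (s + t • d)
    have hw : ‖c x + fderiv ℝ c x (s + t • d)‖
        ≤ (1 - t) * ‖c x + fderiv ℝ c x s‖ + t * ‖c x + fderiv ℝ c x u‖ := by
      have e : c x + fderiv ℝ c x (s + t • d)
          = (1 - t) • (c x + fderiv ℝ c x s) + t • (c x + fderiv ℝ c x u) := by
        rw [hd, map_add, map_smul, map_sub]
        module
      rw [e]
      refine (norm_add_le _ _).trans_eq ?_
      rw [norm_smul, norm_smul, Real.norm_of_nonneg (sub_nonneg.2 ht1),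
        Real.norm_of_nonneg ht.le]
    have hn : ‖s + t • d‖ ^ 2 = ‖s‖ ^ 2 + 2 * (t * ⟪s, d⟫_ℝ) + t ^ 2 * ‖d‖ ^ 2 := by
      rw [norm_add_sq_real, inner_smul_right, norm_smul, mul_pow, Real.norm_eq_abs, sq_abs]
    have hi : ⟪gradient f x + σ • s, d⟫_ℝ = ⟪gradient f x, d⟫_ℝ + σ * ⟪s, d⟫_ℝ := by
      rw [inner_add_left, real_inner_smul_left]
    simp only [phi, psi] at h ⊢
    rw [hn, inner_add_right, inner_smul_right] at h
    rw [hi]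
    have hw' := mul_le_mul_of_nonneg_left hw hτ
    refine le_of_mul_le_mul_left ?_ ht
    linarith
  refine le_of_forall_pos_le_add fun e he => ?_
  set q := 1 / 2 * σ * ‖d‖ ^ 2 with hq
  have hq0 : 0 ≤ q := by positivity
  -- The denominator is `q + 1` because `q` may be zero.
  have h := key (min 1 (e / (q + 1))) (by positivity) (min_le_left _ _)
  have : min 1 (e / (q + 1)) * q ≤ e := by
    calc min 1 (e / (q + 1)) * q ≤ e / (q + 1) * (q + 1) := by
          gcongr
          · exact min_le_right _ _
          · linarith
      _ = e := by field_simp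
  linarith

/-- The variational inequality at `u = 0`. It lets `ξ` absorb model errors quadratic in the step. -/
theorem mul_sq_norm_cauchyPoint_le_xi (hσ : 0 < σ) (hτ : 0 ≤ τ)
    (x : EuclideanSpace ℝ (Fin n)) : σ * ‖cauchyPoint f c σ τ x‖ ^ 2 ≤ xi f c σ τ x := by
  have h := cauchyPoint_variational f c hσ hτ x 0
  rw [zero_sub, inner_neg_right, inner_add_left, real_inner_smul_left,
    real_inner_self_eq_norm_sq] at h
  simp only [xi, penalized, phi]
  simp only [psi, map_zero, add_zero] at h ⊢
  linarith

theorem xi_nonneg (hσ : 0 < σ) (hτ : 0 ≤ τ) (x : EuclideanSpace ℝ (Fin n)) :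
    0 ≤ xi f c σ τ x :=
  le_trans (by positivity) (mul_sq_norm_cauchyPoint_le_xi f c hσ hτ x)

theorem sq_statMeasure (hσ : 0 < σ) (hτ : 0 ≤ τ) (x : EuclideanSpace ℝ (Fin n)) :
    statMeasure f c σ τ x ^ 2 = σ * xi f c σ τ x := by
  rw [statMeasure, mul_pow, Real.sq_sqrt hσ.le, Real.sq_sqrt (xi_nonneg f c hσ hτ x)]

theorem statMeasure_nonneg (x : EuclideanSpace ℝ (Fin n)) : 0 ≤ statMeasure f c σ τ x :=
  mul_nonneg (Real.sqrt_nonneg _) (Real.sqrt_nonneg _)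

theorem mul_norm_cauchyPoint_le_statMeasure (hσ : 0 < σ) (hτ : 0 ≤ τ)
    (x : EuclideanSpace ℝ (Fin n)) :
    σ * ‖cauchyPoint f c σ τ x‖ ≤ statMeasure f c σ τ x := by
  refine le_of_sq_le_sq ?_ (statMeasure_nonneg f c x)
  rw [sq_statMeasure f c hσ hτ]
  have := mul_le_mul_of_nonneg_left (mul_sq_norm_cauchyPoint_le_xi f c hσ hτ x) hσ.le
  linarith

/-- Moves along `±d` with `d` in the kernel of `J` leave `psi` unchanged, so `∇f + σ s` is
orthogonal to that kernel, hence in the range of the adjoint. The residual is `-σ s`. -/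
theorem exists_norm_gradient_sub_adjoint_le (hσ : 0 < σ) (hτ : 0 ≤ τ)
    (x : EuclideanSpace ℝ (Fin n)) :
    ∃ y : EuclideanSpace ℝ (Fin m),
      ‖gradient f x - ContinuousLinearMap.adjoint (fderiv ℝ c x) y‖
        ≤ statMeasure f c σ τ x := by
  have hvi := cauchyPoint_variational f c hσ hτ x
  have hst := mul_norm_cauchyPoint_le_statMeasure f c hσ hτ x
  set s := cauchyPoint f c σ τ x
  have hmem : gradient f x + σ • s ∈ (ContinuousLinearMap.adjoint (fderiv ℝ c x)).range := by
    have hker : gradient f x + σ • s ∈ (fderiv ℝ c x).kerᗮ := by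
      rw [Submodule.mem_orthogonal']
      intro d hd
      have hd0 : fderiv ℝ c x d = 0 := hd
      have h1 := hvi (s + d)
      have h2 := hvi (s - d)
      simp only [psi, map_add, map_sub, hd0, add_zero, sub_zero, sub_self,
        add_sub_cancel_left, sub_sub_cancel_left, inner_neg_right] at h1 h2
      linarith
    have := ContinuousLinearMap.orthogonal_ker (fderiv ℝ c x)
    rw [this] at hker
    rwa [Submodule.topologicalClosure_eq_self] at hker
  obtain ⟨y, hy⟩ := hmem
  refine ⟨y, ?_⟩
  have hy' : ContinuousLinearMap.adjoint (fderiv ℝ c x) y = gradient f x + σ • s := hy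
  rw [hy', sub_add_cancel_left, norm_neg, norm_smul, Real.norm_of_nonneg hσ.le]
  exact hst

/-- For `f = 0` and `σ = τ = 1`, `ξ` is `θ`. -/
theorem sq_norm_feasStep_le_theta (x : EuclideanSpace ℝ (Fin n)) :
    ‖feasStep c x‖ ^ 2 ≤ theta c x := by
  have h := mul_sq_norm_cauchyPoint_le_xi (fun _ => 0) c one_pos zero_le_one x
  have hg : gradient (fun _ : EuclideanSpace ℝ (Fin n) => (0 : ℝ)) x = 0 :=
    gradient_fun_const x 0
  simp only [xi, penalized, phi, psi, hg, inner_zero_left] at h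
  simp only [theta, feasStep]
  linarith

theorem theta_nonneg (x : EuclideanSpace ℝ (Fin n)) : 0 ≤ theta c x :=
  (sq_nonneg _).trans (sq_norm_feasStep_le_theta c x)

/-- Near-stationarity of the penalized problem controls the feasibility measure. -/
theorem mul_theta_le (hσ : 0 < σ) (hτ : 0 ≤ τ) (x : EuclideanSpace ℝ (Fin n)) :
    τ * theta c x ≤ xi f c σ τ x
      + (‖gradient f x‖ + statMeasure f c σ τ x) * √(theta c x) := by
  -- At the feasibility step the constraint model has dropped by exactly `τ θ`, and the step is no
  -- longer than `θ^{1/2}`.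
  have hvi := cauchyPoint_variational f c hσ hτ x (feasStep c x)
  have hst := mul_norm_cauchyPoint_le_statMeasure f c hσ hτ x
  have hxi : xi f c σ τ x = penalized f c τ x
    - (phi f (cauchyPoint f c σ τ x) x + psi c τ (cauchyPoint f c σ τ x) x) := rfl
  set s := cauchyPoint f c σ τ x
  have hr : ‖feasStep c x‖ ≤ √(theta c x) :=
    Real.le_sqrt_of_sq_le (sq_norm_feasStep_le_theta c x)
  have h0 := statMeasure_nonneg (σ := σ) (τ := τ) f c x
  have h1 : ⟪gradient f x, feasStep c x⟫_ℝ ≤ ‖gradient f x‖ * √(theta c x) :=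
    (real_inner_le_norm _ _).trans (by gcongr)
  have h2 : σ * ⟪s, feasStep c x⟫_ℝ ≤ statMeasure f c σ τ x * √(theta c x) := by
    calc σ * ⟪s, feasStep c x⟫_ℝ ≤ σ * (‖s‖ * ‖feasStep c x‖) := by
          gcongr
          exact real_inner_le_norm _ _
      _ = (σ * ‖s‖) * ‖feasStep c x‖ := by ring
      _ ≤ _ := by gcongr
  have h3 : 0 ≤ σ * ‖s‖ ^ 2 := by positivity
  rw [inner_sub_right, inner_add_left, inner_add_left, real_inner_smul_left,
    real_inner_smul_left, real_inner_self_eq_norm_sq] at hvi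
  have ht : τ * theta c x = τ * ‖c x‖ - psi c τ (feasStep c x) x := by
    simp only [theta, psi]; ring
  rw [ht, hxi]
  simp only [penalized, phi]
  linarith

/-- Steps with a large regularization parameter are very successful. -/
theorem le_rho_of_le {κ η : ℝ} (hσ : 0 < σ) (hτ : 0 ≤ τ) {x : EuclideanSpace ℝ (Fin n)}
    (hξ : 0 < xi f c σ τ x) (hκ : 0 ≤ κ)
    (hm : |penalized f c τ (x + cauchyPoint f c σ τ x)
        - (phi f (cauchyPoint f c σ τ x) x + psi c τ (cauchyPoint f c σ τ x) x)|
        ≤ κ * ‖cauchyPoint f c σ τ x‖ ^ 2)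
    (hle : κ ≤ (1 - η) * σ) : η ≤ rho f c σ τ x := by
  have h1 := mul_sq_norm_cauchyPoint_le_xi f c hσ hτ x
  have h2 := (le_abs_self _).trans hm
  have h3 : κ * ‖cauchyPoint f c σ τ x‖ ^ 2 ≤ (1 - η) * xi f c σ τ x := by
    have h4 : 0 ≤ 1 - η := nonneg_of_mul_nonneg_left (hκ.trans hle) hσ
    calc _ ≤ (1 - η) * σ * ‖cauchyPoint f c σ τ x‖ ^ 2 := by gcongr
      _ = (1 - η) * (σ * ‖cauchyPoint f c σ τ x‖ ^ 2) := by ring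
      _ ≤ _ := by gcongr
  rw [rho, le_div_iff₀ hξ]
  have hxi : xi f c σ τ x = penalized f c τ x
    - (phi f (cauchyPoint f c σ τ x) x + psi c τ (cauchyPoint f c σ τ x) x) := rfl
  linarith

end Step

namespace Params

variable (P : Params) {κm₁ κm₂ : ℝ}

theorem γ₁_pos : 0 < P.γ₁ := one_pos.trans P.one_lt_γ₁

theorem γ₂_pos : 0 < P.γ₂ := P.γ₁_pos.trans_le P.γ₁_le_γ₂

theorem α₁_pos : 0 < P.α₁ := div_pos (by positivity) P.η₁_pos

theorem α₂_nonneg : 0 ≤ P.α₂ := abs_nonneg _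

theorem α₃_pos : 0 < P.α₃ :=
  div_pos (mul_pos two_pos P.γ₂_pos) (sub_pos.2 P.η₂_lt_one)

theorem α₄_pos : 0 < P.α₄ κm₁ := P.β₃_pos.trans_le (le_max_left _ _)

theorem α₅_pos : 0 < P.α₅ κm₂ := P.β₄_pos.trans_le (le_max_left _ _)

end Params

/-! ### Complexity of one R2 loop. -/

namespace IsRun

variable {P : Params} {f : EuclideanSpace ℝ (Fin n) → ℝ}
  {c : EuclideanSpace ℝ (Fin n) → EuclideanSpace ℝ (Fin m)}
  {x₀ : EuclideanSpace ℝ (Fin n)} {R : Trace n} {flow κm₁ κm₂ : ℝ} {k : ℕ}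

/-- Regularization parameters stay in `[β₄, α₄ τ_k + α₅]`. -/
theorem sigma_mem_Icc (hR : IsRun P f c x₀ R) (hacc : ModelAccuracy f c R κm₁ κm₂)
    (hτ : 0 < R.τ k) (htol : 0 < R.tol k) {J : ℕ} (hJ : ∀ i < J, ¬ R.InnerStop f c k i) :
    R.σ k J ∈ Set.Icc P.β₄ (P.α₄ κm₁ * R.τ k + P.α₅ κm₂) := by
  obtain ⟨κm, hκ0, hκ, hκle⟩ := hacc
  induction J with
  | zero =>
    rw [hR.σ_init]
    have h1 : P.β₃ * R.τ k ≤ P.α₄ κm₁ * R.τ k := by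
      gcongr; exact le_max_left _ _
    have h2 : P.β₄ ≤ P.α₅ κm₂ := le_max_left _ _
    have h3 : 0 < P.β₃ * R.τ k := mul_pos P.β₃_pos hτ
    have h4 := P.β₄_pos
    exact ⟨le_max_right _ _, max_le (by linarith) (by linarith)⟩
  | succ j ih =>
    obtain ⟨hlo, hhi⟩ := ih fun i hi => hJ i (by omega)
    have hns : ∀ i ≤ j, ¬ R.InnerStop f c k i := fun i hi => hJ i (by omega)
    obtain ⟨-, -, h3, h4, h5⟩ := hR.inner k j hns
    have hσ : 0 < R.σ k j := P.β₄_pos.trans_le hlo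
    rcases le_or_gt P.η₂ (rho f c (R.σ k j) (R.τ k) (R.x k j)) with hv | hv
    · obtain ⟨ha, hb⟩ := h3 hv
      exact ⟨(le_max_right _ _).trans ha, hb.trans hhi⟩
    · have hgrow : R.σ k (j + 1) ∈ Set.Icc (R.σ k j) (P.γ₂ * R.σ k j) := by
        rcases le_or_gt P.η₁ (rho f c (R.σ k j) (R.τ k) (R.x k j)) with hu | hu
        · exact ⟨(h4 hu hv).1, (h4 hu hv).2.trans (by gcongr; exact P.γ₁_le_γ₂)⟩
        · exact ⟨le_trans (by nlinarith [P.one_lt_γ₁]) (h5 hu).1, (h5 hu).2⟩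
      refine ⟨hlo.trans hgrow.1, hgrow.2.trans ?_⟩
      have hξ : 0 < xi f c (R.σ k j) (R.τ k) (R.x k j) := by
        by_contra hcon
        refine hns j le_rfl ?_
        rw [Trace.InnerStop, statMeasure, Real.sqrt_eq_zero'.2 (not_lt.1 hcon), mul_zero]
        exact htol.le
      -- A step that is not very successful forces `σ` to be small, so even an increase by `γ₂`
      -- respects the upper bound.
      have hlt : (1 - P.η₂) * R.σ k j < κm k := by
        by_contra! hcon
        exact absurd (le_rho_of_le f c hσ hτ.le hξ (hκ0 k).le (hκ k j hns) hcon) (not_le.2 hv)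
      have h1η : 0 < 1 - P.η₂ := sub_pos.2 P.η₂_lt_one
      have hσκ : R.σ k j ≤ κm k / (1 - P.η₂) := by
        rw [le_div_iff₀ h1η]; linarith
      have hγ := P.γ₂_pos
      calc P.γ₂ * R.σ k j ≤ P.γ₂ * (κm k / (1 - P.η₂)) := by gcongr
        -- The factor 2 in `α₃` is slack.
        _ ≤ P.α₃ * κm k := by
          rw [Params.α₃, ← mul_div_assoc, div_mul_eq_mul_div]
          have := hκ0 k
          gcongr
          linarith
        _ ≤ P.α₃ * (κm₁ * R.τ k + κm₂) := by
          have := P.α₃_pos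
          gcongr
          exact hκle k
        _ = P.α₃ * κm₁ * R.τ k + P.α₃ * κm₂ := by ring
        _ ≤ _ := by
          gcongr
          · exact le_max_right _ _
          · exact le_max_right _ _

/-- `a` accepted and `b` rejected steps decrease the penalized objective and change the
regularization parameter accordingly. -/
theorem exists_inner_counts (hR : IsRun P f c x₀ R) (hacc : ModelAccuracy f c R κm₁ κm₂)
    (hτ : 0 < R.τ k) (htol : 0 < R.tol k) {J : ℕ} (hJ : ∀ i < J, ¬ R.InnerStop f c k i) :
    ∃ a b : ℕ, a + b = J ∧
      penalized f c (R.τ k) (R.x k J)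
        + a * (P.η₁ * (R.tol k ^ 2 / (P.α₄ κm₁ * R.τ k + P.α₅ κm₂)))
          ≤ penalized f c (R.τ k) (R.x k 0) ∧
      Real.log (R.σ k 0) + a * Real.log P.γ₃ + b * Real.log P.γ₁ ≤ Real.log (R.σ k J) := by
  induction J with
  | zero => exact ⟨0, 0, rfl, by simp, by simp⟩
  | succ j ih =>
    have hlt : ∀ i < j, ¬ R.InnerStop f c k i := fun i hi => hJ i (by omega)
    have hns : ∀ i ≤ j, ¬ R.InnerStop f c k i := fun i hi => hJ i (by omega)
    obtain ⟨a, b, hab, hF, hlog⟩ := ih hlt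
    obtain ⟨hlo, hhi⟩ := hR.sigma_mem_Icc hacc hτ htol hlt
    obtain ⟨hlo', -⟩ := hR.sigma_mem_Icc hacc hτ htol hJ
    obtain ⟨h1, h2, h3, h4, h5⟩ := hR.inner k j hns
    have hσ : 0 < R.σ k j := P.β₄_pos.trans_le hlo
    have hσ' : 0 < R.σ k (j + 1) := P.β₄_pos.trans_le hlo'
    rcases le_or_gt P.η₁ (rho f c (R.σ k j) (R.τ k) (R.x k j)) with hu | hu
    · refine ⟨a + 1, b, by omega, ?_, ?_⟩
      · have hst : R.tol k < statMeasure f c (R.σ k j) (R.τ k) (R.x k j) :=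
          not_le.1 (hns j le_rfl)
        -- The failed inner test bounds `σ ξ` from below; the upper bound on `σ` turns this into a
        -- lower bound on `ξ`.
        have hsq : R.tol k ^ 2 < R.σ k j * xi f c (R.σ k j) (R.τ k) (R.x k j) := by
          rw [← sq_statMeasure f c hσ hτ.le]
          gcongr
        have hξ : 0 < xi f c (R.σ k j) (R.τ k) (R.x k j) :=
          pos_of_mul_pos_right (lt_of_le_of_lt (sq_nonneg _) hsq) hσ.le
        have hge : R.tol k ^ 2 / (P.α₄ κm₁ * R.τ k + P.α₅ κm₂)
            ≤ xi f c (R.σ k j) (R.τ k) (R.x k j) := by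
          rw [div_le_iff₀ (hσ.trans_le hhi), mul_comm]
          exact hsq.le.trans (by gcongr)
        have hdec : P.η₁ * xi f c (R.σ k j) (R.τ k) (R.x k j)
            ≤ penalized f c (R.τ k) (R.x k j) - penalized f c (R.τ k) (R.x k (j + 1)) := by
          rw [h1 hu, ← le_div_iff₀ hξ]
          exact hu
        have := mul_le_mul_of_nonneg_left hge P.η₁_pos.le
        push_cast
        linarith
      · have hge : P.γ₃ * R.σ k j ≤ R.σ k (j + 1) := by
          rcases le_or_gt P.η₂ (rho f c (R.σ k j) (R.τ k) (R.x k j)) with hv | hv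
          · exact (le_max_left _ _).trans (h3 hv).1
          · exact le_trans (mul_le_of_le_one_left hσ.le P.γ₃_le_one) (h4 hu hv).1
        have := Real.log_le_log (mul_pos P.γ₃_pos hσ) hge
        rw [Real.log_mul P.γ₃_pos.ne' hσ.ne'] at this
        push_cast
        linarith
    · refine ⟨a, b + 1, by omega, by rwa [h2 hu], ?_⟩
      have := Real.log_le_log (mul_pos P.γ₁_pos hσ) (h5 hu).1
      rw [Real.log_mul P.γ₁_pos.ne' hσ.ne'] at this
      push_cast
      linarith

/-- Complexity of one inner loop. -/
theorem inner_count_le (hR : IsRun P f c x₀ R) (hacc : ModelAccuracy f c R κm₁ κm₂)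
    (hflow : ∀ x, flow ≤ f x)
    (hτ : P.τ₀ ≤ R.τ k) (htol : 0 < R.tol k) {J : ℕ} (hJ : ∀ i < J, ¬ R.InnerStop f c k i) :
    (J : ℝ) ≤ P.α₁ * (penalized f c (R.τ k) (R.x k 0) - flow)
        * (P.α₄ κm₁ * R.τ k + P.α₅ κm₂) / R.tol k ^ 2
      + P.α₂ * |Real.log ((P.α₄ κm₁ * P.τ₀ + P.α₅ κm₂) / (P.β₃ * P.τ₀))| := by
  have hτ0 := P.τ₀_pos.trans_le hτ
  obtain ⟨a, b, rfl, hF, hlog⟩ := hR.exists_inner_counts hacc hτ0 htol hJ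
  obtain ⟨hlo, hhi⟩ := hR.sigma_mem_Icc hacc hτ0 htol hJ
  have hσJ := P.β₄_pos.trans_le hlo
  have hM := hσJ.trans_le hhi
  have hα₄ := P.α₄_pos (κm₁ := κm₁)
  have hα₅ := P.α₅_pos (κm₂ := κm₂)
  have hη := P.η₁_pos
  have hβ₃ := P.β₃_pos
  have hτi := P.τ₀_pos
  have hγ : 0 < Real.log P.γ₁ := Real.log_pos P.one_lt_γ₁
  have ha : (a : ℝ) ≤ (penalized f c (R.τ k) (R.x k 0) - flow)
      * (P.α₄ κm₁ * R.τ k + P.α₅ κm₂) / R.tol k ^ 2 / P.η₁ := by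
    have h0 : flow ≤ penalized f c (R.τ k) (R.x k (a + b)) :=
      (hflow _).trans (le_add_of_nonneg_right (by positivity))
    rw [le_div_iff₀ hη, le_div_iff₀ (by positivity)]
    have h1 : (a : ℝ) * (P.η₁ * (R.tol k ^ 2 / (P.α₄ κm₁ * R.τ k + P.α₅ κm₂)))
        ≤ penalized f c (R.τ k) (R.x k 0) - flow := by linarith
    calc (a : ℝ) * P.η₁ * R.tol k ^ 2
        = a * (P.η₁ * (R.tol k ^ 2 / (P.α₄ κm₁ * R.τ k + P.α₅ κm₂)))
          * (P.α₄ κm₁ * R.τ k + P.α₅ κm₂) := by field_simp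
      _ ≤ _ := by gcongr
  have hratio : Real.log (R.σ k (a + b)) - Real.log (R.σ k 0)
      ≤ Real.log ((P.α₄ κm₁ * P.τ₀ + P.α₅ κm₂) / (P.β₃ * P.τ₀)) := by
    have h1 : 0 < P.β₃ * R.τ k := by positivity
    have h2 : P.β₃ * R.τ k ≤ R.σ k 0 := by
      rw [hR.σ_init]; exact le_max_left _ _
    have h3 := Real.log_le_log hσJ hhi
    have h4 := Real.log_le_log h1 h2
    -- `(α₄ τ + α₅) / (β₃ τ)` decreases in `τ`, so its value at `τ₀` serves every outer iteration.
    have h5 : Real.log ((P.α₄ κm₁ * R.τ k + P.α₅ κm₂) / (P.β₃ * R.τ k))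
        ≤ Real.log ((P.α₄ κm₁ * P.τ₀ + P.α₅ κm₂) / (P.β₃ * P.τ₀)) := by
      apply Real.log_le_log (by positivity)
      rw [div_le_div_iff₀ h1 (by positivity)]
      have := mul_le_mul_of_nonneg_left hτ (mul_pos hα₅ hβ₃).le
      linarith
    rw [Real.log_div hM.ne' h1.ne'] at h5
    linarith
  -- Balance of `log σ`: rejections can only compensate earlier reductions or use up the total
  -- range. Adding `a` to this bound produces `α₁` and `α₂`.
  have hb : (b : ℝ) ≤ a * (|Real.log P.γ₃| / Real.log P.γ₁)
      + |Real.log ((P.α₄ κm₁ * P.τ₀ + P.α₅ κm₂) / (P.β₃ * P.τ₀))| / Real.log P.γ₁ := by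
    rw [← mul_div_assoc, ← add_div, le_div_iff₀ hγ]
    have h1 := mul_le_mul_of_nonneg_left (neg_abs_le (Real.log P.γ₃)) a.cast_nonneg
    have h2 := hratio.trans (le_abs_self _)
    linarith
  have e1 : |Real.logb P.γ₁ P.γ₃| = |Real.log P.γ₃| / Real.log P.γ₁ := by
    rw [Real.logb, abs_div, abs_of_pos hγ]
  have e2 : P.α₂ = 1 / Real.log P.γ₁ := abs_of_pos (by positivity)
  rw [Params.α₁, e1, e2]
  set q := |Real.log P.γ₃| / Real.log P.γ₁ with hq
  have hq0 : 0 ≤ q := by positivity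
  have h1 := mul_le_mul_of_nonneg_left ha (by positivity : 0 ≤ 1 + q)
  have e3 : (1 + q) / P.η₁ * (penalized f c (R.τ k) (R.x k 0) - flow)
      * (P.α₄ κm₁ * R.τ k + P.α₅ κm₂) / R.tol k ^ 2
      = (1 + q) * ((penalized f c (R.τ k) (R.x k 0) - flow)
      * (P.α₄ κm₁ * R.τ k + P.α₅ κm₂) / R.tol k ^ 2 / P.η₁) := by ring
  rw [e3, one_div_mul_eq_div]
  push_cast
  linarith

theorem exists_innerStop (hR : IsRun P f c x₀ R) (hacc : ModelAccuracy f c R κm₁ κm₂)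
    (hflow : ∀ x, flow ≤ f x) (hτ : P.τ₀ ≤ R.τ k) (htol : 0 < R.tol k) :
    ∃ j, R.InnerStop f c k j := by
  by_contra! h
  obtain ⟨J, hJ⟩ := exists_nat_gt (P.α₁ * (penalized f c (R.τ k) (R.x k 0) - flow)
        * (P.α₄ κm₁ * R.τ k + P.α₅ κm₂) / R.tol k ^ 2
      + P.α₂ * |Real.log ((P.α₄ κm₁ * P.τ₀ + P.α₅ κm₂) / (P.β₃ * P.τ₀))|)
  exact absurd (hR.inner_count_le hacc hflow hτ htol fun i (_ : i < J) => h i) (not_le.2 hJ)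

end IsRun

/-! ### Outer loop: bookkeeping and termination. -/

/-- The outer iterations at which the stopping test holds at a point that was computed with
inner tolerance at most `ε`. -/
def StopsAt (c : EuclideanSpace ℝ (Fin n) → EuclideanSpace ℝ (Fin m)) (R : Trace n)
    (ε : ℝ) (k : ℕ) : Prop :=
  0 < k ∧ R.tol (k - 1) ≤ ε ∧ √(theta c (R.x k 0)) ≤ ε

/-- Before the stopping test holds, the penalty parameter is only increased while below `t`. -/
def IncreasesBelow (P : Params) (c : EuclideanSpace ℝ (Fin n) → EuclideanSpace ℝ (Fin m))
    (R : Trace n) (ε t : ℝ) : Prop :=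
  ∀ k, P.β₂ * ε ≤ R.tol k → R.tol k < √(theta c (R.x (k + 1) 0)) → ¬ StopsAt c R ε (k + 1) →
    R.τ k < t

/-- The maximal number of outer iterations. -/
noncomputable def outerCount (P : Params) (t ε : ℝ) : ℝ :=
  (⌈(t - P.τ₀) / P.β₁⌉₊ : ℝ) + (⌈Real.logb P.β₂ (ε / P.ε₀)⌉₊ : ℝ) + 1

theorem IncreasesBelow.mono {P : Params}
    {c : EuclideanSpace ℝ (Fin n) → EuclideanSpace ℝ (Fin m)} {R : Trace n} {ε t t' : ℝ}
    (h : IncreasesBelow P c R ε t) (htt : t ≤ t') : IncreasesBelow P c R ε t' :=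
  fun k h1 h2 h3 => (h k h1 h2 h3).trans_le htt

namespace IsRun

variable {P : Params} {f : EuclideanSpace ℝ (Fin n) → ℝ}
  {c : EuclideanSpace ℝ (Fin n) → EuclideanSpace ℝ (Fin m)}
  {x₀ : EuclideanSpace ℝ (Fin n)} {R : Trace n} {flow κm₁ κm₂ ε t : ℝ}

/-- The outer update rules apply only after an inner loop that stops, and stopping needs these
bounds; the induction alternates between the two. -/
theorem tau_tol_bounds (hR : IsRun P f c x₀ R) (hacc : ModelAccuracy f c R κm₁ κm₂)
    (hflow : ∀ x, flow ≤ f x) (k : ℕ) :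
    P.τ₀ ≤ R.τ k ∧ 0 < R.tol k ∧ R.tol k ≤ P.ε₀ := by
  induction k with
  | zero => exact ⟨hR.τ_init.ge, hR.tol_init ▸ P.ε₀_pos, hR.tol_init.le⟩
  | succ k ih =>
    obtain ⟨h1, h2, h3⟩ := ih
    have hst := hR.exists_innerStop hacc hflow h1 h2
    have hβ₁ := P.β₁_pos
    rcases lt_or_ge (R.tol k) √(theta c (R.x (k + 1) 0)) with h | h
    · obtain ⟨h4, h5⟩ := hR.outer_increase k hst h
      rw [h5]
      exact ⟨by linarith, h2, h3⟩
    · obtain ⟨h4, h5⟩ := hR.outer_keep k hst h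
      rw [h4, h5]
      exact ⟨h1, mul_pos P.β₂_pos h2, (mul_le_of_le_one_left h2.le P.β₂_lt_one.le).trans h3⟩

theorem innerStop (hR : IsRun P f c x₀ R) (hacc : ModelAccuracy f c R κm₁ κm₂)
    (hflow : ∀ x, flow ≤ f x) (k : ℕ) : ∃ j, R.InnerStop f c k j :=
  hR.exists_innerStop hacc hflow (hR.tau_tol_bounds hacc hflow k).1
    (hR.tau_tol_bounds hacc hflow k).2.1

theorem tau_le_succ (hR : IsRun P f c x₀ R) (hacc : ModelAccuracy f c R κm₁ κm₂)
    (hflow : ∀ x, flow ≤ f x) (k : ℕ) : R.τ k ≤ R.τ (k + 1) := by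
  have hst := hR.innerStop hacc hflow k
  have hβ₁ := P.β₁_pos
  rcases lt_or_ge (R.tol k) √(theta c (R.x (k + 1) 0)) with h | h
  · linarith [(hR.outer_increase k hst h).1]
  · exact (hR.outer_keep k hst h).1.ge

theorem not_innerStop_of_lt_innerCount {k i : ℕ} (hi : i < R.innerCount f c k) :
    ¬ R.InnerStop f c k i :=
  Nat.notMem_of_lt_sInf hi

theorem x_succ (hR : IsRun P f c x₀ R) {k : ℕ} (h : ∃ j, R.InnerStop f c k j) :
    R.x (k + 1) 0 = R.x k (R.innerCount f c k) :=
  hR.outer_x k _ ⟨Nat.sInf_mem h, fun _ hj => Nat.sInf_le hj⟩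

/-- The point produced by an inner loop is nearly stationary for the penalized problem. -/
theorem exists_statMeasure_le (hR : IsRun P f c x₀ R) (hacc : ModelAccuracy f c R κm₁ κm₂)
    (hflow : ∀ x, flow ≤ f x) (k : ℕ) :
    ∃ σ, P.β₄ ≤ σ ∧ statMeasure f c σ (R.τ k) (R.x (k + 1) 0) ≤ R.tol k := by
  have h := hR.innerStop hacc hflow k
  obtain ⟨h1, h2, -⟩ := hR.tau_tol_bounds hacc hflow k
  refine ⟨_, (hR.sigma_mem_Icc hacc (P.τ₀_pos.trans_le h1) h2
    fun i hi => not_innerStop_of_lt_innerCount hi).1, ?_⟩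
  rw [hR.x_succ h]
  exact Nat.sInf_mem h

theorem penalized_succ_le (hR : IsRun P f c x₀ R) (hacc : ModelAccuracy f c R κm₁ κm₂)
    (hflow : ∀ x, flow ≤ f x) (k : ℕ) :
    penalized f c (R.τ k) (R.x (k + 1) 0) ≤ penalized f c (R.τ k) (R.x k 0) := by
  obtain ⟨h1, h2, -⟩ := hR.tau_tol_bounds hacc hflow k
  have hτ := P.τ₀_pos.trans_le h1
  obtain ⟨a, b, -, hF, -⟩ := hR.exists_inner_counts hacc hτ h2
    fun i (hi : i < R.innerCount f c k) => not_innerStop_of_lt_innerCount hi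
  rw [hR.x_succ (hR.innerStop hacc hflow k)]
  have hη := P.η₁_pos
  have hα₄ := P.α₄_pos (κm₁ := κm₁)
  have hα₅ := P.α₅_pos (κm₂ := κm₂)
  have : 0 ≤ (a : ℝ) * (P.η₁ * (R.tol k ^ 2 / (P.α₄ κm₁ * R.τ k + P.α₅ κm₂))) := by
    positivity
  linarith

/-- The gap of the penalized objective grows at most linearly with the penalty parameter. -/
theorem penalized_sub_le (hR : IsRun P f c x₀ R) (hacc : ModelAccuracy f c R κm₁ κm₂)
    (hflow : ∀ x, flow ≤ f x) (k : ℕ) :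
    penalized f c (R.τ k) (R.x k 0) - flow
      ≤ R.τ k * ((penalized f c P.τ₀ x₀ - flow) / P.τ₀) := by
  have hτ k : 0 < R.τ k := P.τ₀_pos.trans_le (hR.tau_tol_bounds hacc hflow k).1
  induction k with
  | zero =>
    rw [hR.x_init, hR.τ_init, mul_div_cancel₀ _ P.τ₀_pos.ne']
  | succ k ih =>
    -- The gap over `τ` is `(f - flow) / τ + ‖c‖`: the inner loop does not raise it, nor does a
    -- larger `τ`, since `f ≥ flow`.
    have h1 := (sub_le_sub_right (hR.penalized_succ_le hacc hflow k) flow).trans ih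
    rw [← div_le_iff₀' (hτ _)] at h1 ⊢
    refine le_trans ?_ h1
    have h2 := hflow (R.x (k + 1) 0)
    rw [div_le_div_iff₀ (hτ _) (hτ _)]
    simp only [penalized]
    have h3 := mul_le_mul_of_nonneg_left (hR.tau_le_succ hacc hflow k) (sub_nonneg.2 h2)
    linarith

/-- Bookkeeping of the outer iterations: `a` increases of the penalty parameter and `b`
reductions of the tolerance. -/
theorem exists_outer_counts (hR : IsRun P f c x₀ R) (hacc : ModelAccuracy f c R κm₁ κm₂)
    (hflow : ∀ x, flow ≤ f x) (hε : 0 < ε) (hε₀ : ε ≤ P.ε₀) (hinc : IncreasesBelow P c R ε t)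
    {k : ℕ} (hk : ∀ l ≤ k, ¬ StopsAt c R ε l) :
    P.β₂ * ε ≤ R.tol k ∧ ∃ a b : ℕ, a + b = k ∧ a ≤ ⌈(t - P.τ₀) / P.β₁⌉₊ ∧
      b ≤ ⌈Real.logb P.β₂ (ε / P.ε₀)⌉₊ ∧ P.τ₀ + a * P.β₁ ≤ R.τ k ∧
      R.tol k = P.β₂ ^ b * P.ε₀ := by
  have hβ₂ := P.β₂_pos
  have hε0 := P.ε₀_pos
  induction k with
  | zero =>
    refine ⟨?_, 0, 0, rfl, zero_le, zero_le, by simp [hR.τ_init], by simp [hR.tol_init]⟩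
    rw [hR.tol_init]
    exact (mul_le_of_le_one_left hε.le P.β₂_lt_one.le).trans hε₀
  | succ k ih =>
    obtain ⟨htol, a, b, hab, ha, hb, hτ, htolb⟩ := ih fun l hl => hk l (by omega)
    have hns := hk (k + 1) le_rfl
    have hst := hR.innerStop hacc hflow k
    rcases lt_or_ge (R.tol k) √(theta c (R.x (k + 1) 0)) with h | h
    · obtain ⟨h4, h5⟩ := hR.outer_increase k hst h
      have hlt := hinc k htol h hns
      rw [h5]
      refine ⟨htol, a + 1, b, by omega, ?_, hb, by push_cast; linarith, htolb⟩
      -- `a + 1 ≤ ⌈·⌉₊` means `a < ⌈·⌉₊`, which follows from `τ₀ + a β₁ ≤ τ_k < t`.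
      apply Nat.lt_ceil.2
      rw [lt_div_iff₀ P.β₁_pos]
      linarith
    · obtain ⟨h4, h5⟩ := hR.outer_keep k hst h
      -- A cut at a tolerance already at most `ε` would mean that `x_{k+1}` passes the stopping
      -- test.
      have hlt : ε < R.tol k := by
        by_contra! hle
        exact hns ⟨k.succ_pos, hle, h.trans hle⟩
      rw [h4, h5]
      refine ⟨by gcongr, a, b + 1, by omega, ha, ?_, hτ, by rw [htolb]; ring⟩
      apply Nat.lt_ceil.2
      have h6 : ε / P.ε₀ < P.β₂ ^ (b : ℝ) := by
        rw [div_lt_iff₀ hε0, Real.rpow_natCast]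
        linarith
      calc (b : ℝ) = Real.logb P.β₂ (P.β₂ ^ (b : ℝ)) :=
            (Real.logb_rpow hβ₂ P.β₂_lt_one.ne).symm
        _ < _ := (Real.logb_lt_logb_iff_of_base_lt_one hβ₂ P.β₂_lt_one
            (by positivity) (by positivity)).2 h6

theorem natCast_le_outerCount (hR : IsRun P f c x₀ R) (hacc : ModelAccuracy f c R κm₁ κm₂)
    (hflow : ∀ x, flow ≤ f x) (hε : 0 < ε) (hε₀ : ε ≤ P.ε₀) (hinc : IncreasesBelow P c R ε t)
    {K : ℕ} (hK : ∀ l < K, ¬ StopsAt c R ε l) : (K : ℝ) ≤ outerCount P t ε := by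
  unfold outerCount
  cases K with
  | zero => push_cast; positivity
  | succ k =>
    -- The counts are taken at the index `K - 1`, whence the final `+ 1` in `outerCount`.
    obtain ⟨-, a, b, hab, ha, hb, -, -⟩ :=
      hR.exists_outer_counts hacc hflow hε hε₀ hinc (k := k) fun l hl => hK l (by omega)
    have : k + 1 ≤ ⌈(t - P.τ₀) / P.β₁⌉₊ + ⌈Real.logb P.β₂ (ε / P.ε₀)⌉₊ + 1 := by omega
    exact_mod_cast this

theorem beta_mul_le_tol (hR : IsRun P f c x₀ R) (hacc : ModelAccuracy f c R κm₁ κm₂)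
    (hflow : ∀ x, flow ≤ f x) (hε : 0 < ε) (hε₀ : ε ≤ P.ε₀) (hinc : IncreasesBelow P c R ε t)
    {K k : ℕ} (hK : ∀ l < K, ¬ StopsAt c R ε l) (hk : k < K) : P.β₂ * ε ≤ R.tol k :=
  (hR.exists_outer_counts hacc hflow hε hε₀ hinc fun l hl => hK l (by omega)).1

/-- Only values below `t` are increased, so `t` is overshot by a factor `Λ` at most. The `max` with
1 covers `τ₀` and unchanged values. -/
theorem tau_le_max {Λ : ℝ} (hR : IsRun P f c x₀ R) (hacc : ModelAccuracy f c R κm₁ κm₂)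
    (hflow : ∀ x, flow ≤ f x) (hε : 0 < ε) (hε₀ : ε ≤ P.ε₀) (hinc : IncreasesBelow P c R ε t)
    (hΛ : ∀ k, R.τ (k + 1) ≤ Λ * R.τ k) (ht : P.τ₀ ≤ t)
    {K k : ℕ} (hK : ∀ l < K, ¬ StopsAt c R ε l) (hk : k < K) :
    R.τ k ≤ max 1 |Λ| * t := by
  have ht0 : 0 < t := P.τ₀_pos.trans_le ht
  induction k with
  | zero =>
    rw [hR.τ_init]
    exact ht.trans (le_mul_of_one_le_left ht0.le (le_max_left _ _))
  | succ k ih =>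
    have hst := hR.innerStop hacc hflow k
    rcases lt_or_ge (R.tol k) √(theta c (R.x (k + 1) 0)) with h | h
    · have hlt := hinc k (hR.beta_mul_le_tol hacc hflow hε hε₀ hinc hK (by omega)) h (hK _ hk)
      have hτ := P.τ₀_pos.trans_le (hR.tau_tol_bounds hacc hflow k).1
      refine (hΛ k).trans ?_
      gcongr
      exact (le_abs_self _).trans (le_max_right _ _)
    · rw [(hR.outer_keep k hst h).1]
      exact ih (by omega)

theorem approxKKT_or_infeasible (hR : IsRun P f c x₀ R) (hacc : ModelAccuracy f c R κm₁ κm₂)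
    (hflow : ∀ x, flow ≤ f x) {K : ℕ} (hK : 0 < K) (hθ : √(theta c (R.x K 0)) ≤ ε) :
    IsApproxKKT f c (R.tol (K - 1)) ε (R.x K 0)
      ∨ IsApproxInfeasibleCritical c ε (R.x K 0) := by
  obtain ⟨k, rfl⟩ := Nat.exists_eq_add_of_lt hK
  rw [zero_add] at hθ ⊢
  rcases le_or_gt ‖c (R.x (k + 1) 0)‖ ε with h | h
  · obtain ⟨σ, hσ, hst⟩ := hR.exists_statMeasure_le hacc hflow k
    have hτ := P.τ₀_pos.trans_le (hR.tau_tol_bounds hacc hflow k).1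
    obtain ⟨y, hy⟩ := exists_norm_gradient_sub_adjoint_le f c (P.β₄_pos.trans_le hσ) hτ.le
      (R.x (k + 1) 0)
    exact Or.inl ⟨⟨y, hy.trans hst⟩, h⟩
  · exact Or.inr ⟨h, hθ⟩

theorem terminatesAtCritical (hR : IsRun P f c x₀ R) (hacc : ModelAccuracy f c R κm₁ κm₂)
    (hflow : ∀ x, flow ≤ f x) (hε : 0 < ε) (hε₀ : ε ≤ P.ε₀)
    (hinc : IncreasesBelow P c R ε t) : TerminatesAtCritical f c R ε := by
  classical
  have hex : ∃ k, StopsAt c R ε k := by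
    by_contra! h
    obtain ⟨K, hK⟩ := exists_nat_gt (outerCount P t ε)
    exact absurd (hR.natCast_le_outerCount hacc hflow hε hε₀ hinc fun l (_ : l < K) => h l)
      (not_le.2 hK)
  have hex' : ∃ k, √(theta c (R.x k 0)) ≤ ε := hex.imp fun k hk => hk.2.2
  refine ⟨hR.innerStop hacc hflow,
    ⟨Nat.find hex', ⟨Nat.find_spec hex', fun k hk => Nat.find_min' hex' hk⟩,
      fun h0 => hR.approxKKT_or_infeasible hacc hflow h0 (Nat.find_spec hex')⟩,
    ⟨Nat.find hex, ⟨Nat.find_spec hex, fun k hk => Nat.find_min' hex hk⟩, ?_⟩⟩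
  obtain ⟨h0, h1, h2⟩ := Nat.find_spec hex
  refine (hR.approxKKT_or_infeasible hacc hflow h0 h2).imp_left ?_
  rintro ⟨⟨y, hy⟩, hc⟩
  exact ⟨⟨y, hy.trans h1⟩, hc⟩

end IsRun

/-- A stop also passes the weaker test defining `k(ε)`, so `k(ε) ≤ K(ε)` and one set of estimates
serves both indices. -/
theorem not_stopsAt_of_lt {c : EuclideanSpace ℝ (Fin n) → EuclideanSpace ℝ (Fin m)}
    {R : Trace n} {ε : ℝ} {K l : ℕ} (hK : IsFeasIndex c R ε K ∨ IsStopIndex c R ε K)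
    (hl : l < K) : ¬ StopsAt c R ε l := fun h =>
  not_le.2 hl (hK.elim (fun hK => hK.2 h.2.2) fun hK => hK.2 h)

/-- An increase with `τ_k ≥ t` would give `ε_k < θ^{1/2} < ε` at `x_{k+1}`, which is then a stop. -/
theorem increasesBelow_of_theta_lt {P : Params}
    {c : EuclideanSpace ℝ (Fin n) → EuclideanSpace ℝ (Fin m)} {R : Trace n} {ε t : ℝ}
    (h : ∀ k, t ≤ R.τ k → √(theta c (R.x (k + 1) 0)) < ε) : IncreasesBelow P c R ε t := by
  intro k _ hk hns
  by_contra! hcon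
  have := h k hcon
  exact hns ⟨k.succ_pos, (hk.trans this).le, this.le⟩

/-- The two roundings and the final `+ 1` cost 3, which is at most `3 t / τ₀`. -/
theorem outerCount_le {P : Params} {t ε : ℝ} (ht : P.τ₀ ≤ t) (hε : 0 < ε) (hε₀ : ε ≤ P.ε₀) :
    outerCount P t ε
      ≤ (1 / P.β₁ + 1 / |Real.log P.β₂| + 3 / P.τ₀) * (t + |Real.log (ε / P.ε₀)|) := by
  have hβ₁ := P.β₁_pos
  have hτ₀ := P.τ₀_pos
  have hlogβ : Real.log P.β₂ < 0 := Real.log_neg P.β₂_pos P.β₂_lt_one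
  have hl : Real.log (ε / P.ε₀) ≤ 0 :=
    Real.log_nonpos (div_pos hε P.ε₀_pos).le ((div_le_one P.ε₀_pos).2 hε₀)
  have e : Real.logb P.β₂ (ε / P.ε₀) = 1 / |Real.log P.β₂| * |Real.log (ε / P.ε₀)| := by
    rw [Real.logb, abs_of_neg hlogβ, abs_of_nonpos hl]
    field_simp
  have h1 := Nat.ceil_lt_add_one (div_nonneg (sub_nonneg.2 ht) hβ₁.le)
  have h2 := Nat.ceil_lt_add_one (a := Real.logb P.β₂ (ε / P.ε₀)) (by rw [e]; positivity)
  rw [e] at h2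
  rw [outerCount, e]
  have h3 : 1 ≤ t / P.τ₀ := (one_le_div hτ₀).2 ht
  have h4 : (t - P.τ₀) / P.β₁ ≤ 1 / P.β₁ * t := by
    rw [one_div_mul_eq_div]
    gcongr
    linarith
  have h5 : 3 / P.τ₀ * t = 3 * (t / P.τ₀) := by ring
  have ht0 := hτ₀.trans_le ht
  have h6 : 0 ≤ 1 / |Real.log P.β₂| * t := by positivity
  have h7 : 0 ≤ 1 / P.β₁ * |Real.log (ε / P.ε₀)| := by positivity
  have h8 : 0 ≤ 3 / P.τ₀ * |Real.log (ε / P.ε₀)| := by positivity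
  rw [add_mul, add_mul, mul_add, mul_add, mul_add]
  linarith

/-! ### Total counts, and the threshold for bounded gradients. -/

namespace IsRun

variable {P : Params} {f : EuclideanSpace ℝ (Fin n) → ℝ}
  {c : EuclideanSpace ℝ (Fin n) → EuclideanSpace ℝ (Fin m)}
  {x₀ : EuclideanSpace ℝ (Fin n)} {R : Trace n} {flow κm₁ κm₂ ε t : ℝ}

/-- If the penalty parameters and the gaps are bounded by `T` and `G` in outer iterations
`k < K`, so is the total number of inner iterations. -/
theorem totalInner_le (hR : IsRun P f c x₀ R) (hacc : ModelAccuracy f c R κm₁ κm₂)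
    (hflow : ∀ x, flow ≤ f x) (hε : 0 < ε) (hε₀ : ε ≤ P.ε₀) (hinc : IncreasesBelow P c R ε t)
    {K : ℕ} (hK : ∀ l < K, ¬ StopsAt c R ε l) {G T : ℝ} (hG0 : 0 ≤ G) (hT0 : 0 ≤ T)
    (hT : ∀ k < K, R.τ k ≤ T) (hG : ∀ k < K, penalized f c (R.τ k) (R.x k 0) - flow ≤ G) :
    (R.totalInner f c K : ℝ) ≤ outerCount P t ε *
      (P.α₁ * G * (P.α₄ κm₁ * T + P.α₅ κm₂) / (P.β₂ * ε) ^ 2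
        + P.α₂ * |Real.log ((P.α₄ κm₁ * P.τ₀ + P.α₅ κm₂) / (P.β₃ * P.τ₀))|) := by
  have hα₁ := P.α₁_pos
  have hα₂ := P.α₂_nonneg
  have hα₄ := P.α₄_pos (κm₁ := κm₁)
  have hα₅ := P.α₅_pos (κm₂ := κm₂)
  have hβ₂ := P.β₂_pos
  set B := P.α₁ * G * (P.α₄ κm₁ * T + P.α₅ κm₂) / (P.β₂ * ε) ^ 2
        + P.α₂ * |Real.log ((P.α₄ κm₁ * P.τ₀ + P.α₅ κm₂) / (P.β₃ * P.τ₀))| with hBdef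
  have hB : 0 ≤ B := by positivity
  have hle : ∀ k ∈ Finset.range K, (R.innerCount f c k : ℝ) ≤ B := by
    intro k hk
    rw [Finset.mem_range] at hk
    obtain ⟨h1, h2, -⟩ := hR.tau_tol_bounds hacc hflow k
    have hτ := P.τ₀_pos.trans_le h1
    refine (hR.inner_count_le hacc hflow h1 h2
      fun i hi => not_innerStop_of_lt_innerCount hi).trans ?_
    rw [hBdef]
    gcongr
    · exact hG k hk
    · exact hT k hk
    · exact hR.beta_mul_le_tol hacc hflow hε hε₀ hinc hK hk
  rw [Trace.totalInner, Nat.cast_sum]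
  refine (Finset.sum_le_card_nsmul _ _ _ hle).trans ?_
  rw [Finset.card_range, nsmul_eq_mul]
  gcongr
  exact hR.natCast_le_outerCount hacc hflow hε hε₀ hinc hK

theorem totalInner_le_complexityBound (hR : IsRun P f c x₀ R)
    (hacc : ModelAccuracy f c R κm₁ κm₂) (hflow : ∀ x, flow ≤ f x) (hε : 0 < ε)
    (hε₀ : ε ≤ P.ε₀) (ht : 0 ≤ t) (hinc : IncreasesBelow P c R ε t)
    {K : ℕ} (hK : ∀ l < K, ¬ StopsAt c R ε l) :
    (R.totalInner f c K : ℝ) ≤ complexityBound P f c flow κm₁ κm₂ R t ε K := by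
  have hH0 : 0 ≤ kappaH c R K := Real.iSup_nonneg fun _ => norm_nonneg _
  have hF0 : 0 ≤ kappaF f flow R K := Real.iSup_nonneg fun _ => sub_nonneg.2 (hflow _)
  have hT0 : 0 ≤ tauHat R t K := ht.trans (le_max_left _ _)
  have hT : ∀ k < K, R.τ k ≤ tauHat R t K := fun k hk =>
    (le_ciSup (f := fun k : Fin K => R.τ k) (Set.finite_range _).bddAbove ⟨k, hk⟩).trans
      (le_max_right _ _)
  refine hR.totalInner_le hacc hflow hε hε₀ hinc hK (by positivity) hT0 hT fun k hk => ?_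
  have h1 : ‖c (R.x k 0)‖ ≤ kappaH c R K :=
    le_ciSup (f := fun k : Fin K => ‖c (R.x k 0)‖) (Set.finite_range _).bddAbove ⟨k, hk⟩
  have h2 : f (R.x k 0) - flow ≤ kappaF f flow R K :=
    le_ciSup (f := fun k : Fin K => f (R.x k 0) - flow) (Set.finite_range _).bddAbove ⟨k, hk⟩
  have h3 : R.τ k * ‖c (R.x k 0)‖ ≤ kappaH c R K * tauHat R t K := by
    rw [mul_comm]
    exact mul_le_mul h1 (hT k hk)
      (P.τ₀_pos.le.trans (hR.tau_tol_bounds hacc hflow k).1) hH0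
  simp only [penalized]
  linarith

/-- With bounded gradients, the penalty parameter is only increased while of order `ε⁻¹`. -/
theorem increasesBelow_of_gradient_le (hR : IsRun P f c x₀ R)
    (hacc : ModelAccuracy f c R κm₁ κm₂) (hflow : ∀ x, flow ≤ f x) (hε : 0 < ε) {κg : ℝ}
    (hg : ∀ k, ‖gradient f (R.x k 0)‖ ≤ κg) :
    IncreasesBelow P c R ε ((P.ε₀ / P.β₄ + κg + P.ε₀) / (P.β₂ * ε)) := by
  intro k htol hlt _
  obtain ⟨hτ0, htol0, htolle⟩ := hR.tau_tol_bounds hacc hflow k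
  have hτ := P.τ₀_pos.trans_le hτ0
  obtain ⟨σ, hσβ, hst⟩ := hR.exists_statMeasure_le hacc hflow k
  have hβ₄ := P.β₄_pos
  have hβ₂ := P.β₂_pos
  have hσ := hβ₄.trans_le hσβ
  set x := R.x (k + 1) 0
  set δ := √(theta c x) with hδ
  have hδ0 : 0 < δ := htol0.trans hlt
  have hθ : theta c x = δ ^ 2 := (Real.sq_sqrt (theta_nonneg c x)).symm
  have h1 := mul_theta_le f c hσ hτ.le x
  -- Of the two factors in `ε_k²`, one is bounded by `ε₀` and the other by `δ`, so that `δ` cancels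
  -- below.
  have hξ : xi f c σ (R.τ k) x ≤ P.ε₀ / P.β₄ * δ := by
    have h2 : σ * xi f c σ (R.τ k) x ≤ R.tol k ^ 2 := by
      rw [← sq_statMeasure f c hσ hτ.le]
      have := statMeasure_nonneg (σ := σ) (τ := R.τ k) f c x
      gcongr
    rw [div_mul_eq_mul_div, le_div_iff₀' hβ₄]
    calc P.β₄ * xi f c σ (R.τ k) x ≤ σ * xi f c σ (R.τ k) x := by
          have := xi_nonneg f c hσ hτ.le x
          gcongr
      _ ≤ R.tol k * R.tol k := by rwa [← sq]
      _ ≤ P.ε₀ * δ := mul_le_mul htolle hlt.le htol0.le P.ε₀_pos.le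
  have h3 : (‖gradient f x‖ + statMeasure f c σ (R.τ k) x) * δ ≤ (κg + P.ε₀) * δ := by
    gcongr
    · exact hg (k + 1)
    · exact hst.trans htolle
  have h4 : R.τ k * δ ≤ P.ε₀ / P.β₄ + κg + P.ε₀ := by
    refine le_of_mul_le_mul_right ?_ hδ0
    rw [← hδ, hθ] at h1
    linarith
  rw [lt_div_iff₀ (by positivity)]
  exact lt_of_lt_of_le (by gcongr; exact htol.trans_lt hlt) h4

end IsRun

/-! ### Orders in the tolerance, and assembly. -/

/-- Order of the total number of inner iterations when the penalty parameter is only increased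
below `t`, and at most by a constant factor. -/
theorem exists_totalInner_le_order (P : Params) (f : EuclideanSpace ℝ (Fin n) → ℝ)
    (c : EuclideanSpace ℝ (Fin n) → EuclideanSpace ℝ (Fin m)) (x₀ : EuclideanSpace ℝ (Fin n))
    {flow : ℝ} (hflow : ∀ x, flow ≤ f x) (κm₁ κm₂ Λ : ℝ) :
    ∃ C : ℝ, 0 < C ∧ ∀ ε : ℝ, 0 < ε → ε ≤ P.ε₀ → ∀ R : Trace n, IsRun P f c x₀ R →
      ModelAccuracy f c R κm₁ κm₂ → (∀ k, R.τ (k + 1) ≤ Λ * R.τ k) →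
      ∀ t : ℝ, P.τ₀ ≤ t → IncreasesBelow P c R ε t →
        ∀ K, IsFeasIndex c R ε K ∨ IsStopIndex c R ε K →
          (R.totalInner f c K : ℝ)
            ≤ C * ((t + |Real.log (ε / P.ε₀)|) * t ^ 2 * ε⁻¹ ^ 2) := by
  have hα₁ := P.α₁_pos
  have hα₂ := P.α₂_nonneg
  have hα₄ := P.α₄_pos (κm₁ := κm₁)
  have hα₅ := P.α₅_pos (κm₂ := κm₂)
  have hβ₂ := P.β₂_pos
  have hβ₁ := P.β₁_pos
  have hτ₀ := P.τ₀_pos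
  have hε0 := P.ε₀_pos
  have hH0 : 0 ≤ (penalized f c P.τ₀ x₀ - flow) / P.τ₀ := by
    refine div_nonneg (sub_nonneg.2 ?_) hτ₀.le
    exact (hflow x₀).trans (le_add_of_nonneg_right (by positivity))
  set H := (penalized f c P.τ₀ x₀ - flow) / P.τ₀
  set L := max 1 |Λ| with hLdef
  have hL : 0 < L := one_pos.trans_le (le_max_left _ _)
  set D := P.α₂ * |Real.log ((P.α₄ κm₁ * P.τ₀ + P.α₅ κm₂) / (P.β₃ * P.τ₀))| with hDdef
  have hD : 0 ≤ D := by positivity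
  -- Since `t ≥ τ₀` and `ε ≤ ε₀`, lower-order terms are raised to `t² ε⁻²`; the `+ 1` only ensures
  -- positivity.
  set C₁ := P.α₁ * (L * H) * (P.α₄ κm₁ * L + P.α₅ κm₂ / P.τ₀) / P.β₂ ^ 2
    + D * (P.ε₀ ^ 2 / P.τ₀ ^ 2) + 1 with hC₁
  set C₂ := 1 / P.β₁ + 1 / |Real.log P.β₂| + 3 / P.τ₀
  have hC₁0 : 0 < C₁ := by positivity
  have hC₂0 : 0 < C₂ := by positivity
  refine ⟨C₂ * C₁, by positivity, fun ε hε hε₀ R hR hacc hΛ t ht hinc K hK => ?_⟩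
  have hns : ∀ l < K, ¬ StopsAt c R ε l := fun l hl => not_stopsAt_of_lt hK hl
  have ht0 := hτ₀.trans_le ht
  have hT : ∀ k < K, R.τ k ≤ L * t := fun k hk =>
    hR.tau_le_max hacc hflow hε hε₀ hinc hΛ ht hns hk
  refine (hR.totalInner_le (flow := flow) hacc hflow hε hε₀ hinc hns (G := L * t * H)
    (T := L * t) (by positivity) (by positivity) hT fun k hk => ?_).trans ?_
  · exact (hR.penalized_sub_le hacc hflow k).trans (by gcongr; exact hT k hk)
  · rw [← hDdef]
    have h1 : P.α₁ * (L * t * H) * (P.α₄ κm₁ * (L * t) + P.α₅ κm₂) / (P.β₂ * ε) ^ 2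
        ≤ P.α₁ * (L * H) * (P.α₄ κm₁ * L + P.α₅ κm₂ / P.τ₀) / P.β₂ ^ 2
          * (t ^ 2 * ε⁻¹ ^ 2) := by
      have h2 : P.α₅ κm₂ ≤ P.α₅ κm₂ / P.τ₀ * t := by
        rw [div_mul_eq_mul_div, le_div_iff₀ hτ₀]
        gcongr
      calc _ ≤ P.α₁ * (L * t * H) * (P.α₄ κm₁ * (L * t) + P.α₅ κm₂ / P.τ₀ * t)
            / (P.β₂ * ε) ^ 2 := by gcongr
        _ = _ := by field_simp
    have h3 : D ≤ D * (P.ε₀ ^ 2 / P.τ₀ ^ 2) * (t ^ 2 * ε⁻¹ ^ 2) := by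
      have h4 : 1 ≤ (P.ε₀ ^ 2 / P.τ₀ ^ 2) * (t ^ 2 * ε⁻¹ ^ 2) := by
        have e : (P.ε₀ ^ 2 / P.τ₀ ^ 2) * (t ^ 2 * ε⁻¹ ^ 2)
            = ((P.ε₀ / ε) * (t / P.τ₀)) ^ 2 := by field_simp
        rw [e]
        exact one_le_pow₀ (one_le_mul_of_one_le_of_one_le ((one_le_div hε).2 hε₀)
          ((one_le_div hτ₀).2 ht))
      rw [mul_assoc]
      exact le_mul_of_one_le_right hD h4
    have h5 : 0 ≤ t ^ 2 * ε⁻¹ ^ 2 := by positivity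
    calc _ ≤ (C₂ * (t + |Real.log (ε / P.ε₀)|)) * (C₁ * (t ^ 2 * ε⁻¹ ^ 2)) := by
          refine mul_le_mul (outerCount_le ht hε hε₀) ?_ (by positivity) (by positivity)
          rw [hC₁]
          linarith
      _ = _ := by ring

/-- With bounded gradients the order of the total number of inner iterations is `ε⁻⁸`. -/
theorem order_le_of_gradient_bound (P : Params) {M ε : ℝ} (hM : 0 < M) (hε : 0 < ε)
    (hε₀ : ε ≤ P.ε₀) :
    (max P.τ₀ (M / ε) + |Real.log (ε / P.ε₀)|) * max P.τ₀ (M / ε) ^ 2 * ε⁻¹ ^ 2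
      ≤ ((P.τ₀ * P.ε₀ + M + P.ε₀) * (P.τ₀ * P.ε₀ + M) ^ 2 * P.ε₀ ^ 3) * ε⁻¹ ^ 8 := by
  have hτ₀ := P.τ₀_pos
  have hε0 := P.ε₀_pos
  have h1 : max P.τ₀ (M / ε) ≤ (P.τ₀ * P.ε₀ + M) * ε⁻¹ := by
    rw [← div_eq_mul_inv]
    refine max_le ?_ ?_
    · rw [le_div_iff₀ hε]
      nlinarith
    · gcongr
      have : 0 < P.τ₀ * P.ε₀ := by positivity
      linarith
  have h2 : |Real.log (ε / P.ε₀)| ≤ P.ε₀ * ε⁻¹ := by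
    rw [abs_of_nonpos (Real.log_nonpos (by positivity) ((div_le_one hε0).2 hε₀)), ← Real.log_inv,
      inv_div, ← div_eq_mul_inv]
    exact Real.log_le_self (by positivity)
  have h3 : 1 ≤ P.ε₀ * ε⁻¹ := by
    rw [← div_eq_mul_inv]
    exact (one_le_div hε).2 hε₀
  calc _ ≤ ((P.τ₀ * P.ε₀ + M) * ε⁻¹ + P.ε₀ * ε⁻¹) * ((P.τ₀ * P.ε₀ + M) * ε⁻¹) ^ 2
        * ε⁻¹ ^ 2 := by gcongr
    -- The estimate so far is of order `ε⁻⁵`; a factor `(ε₀/ε)³ ≥ 1` weakens it to `ε⁻⁸`.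
    _ ≤ ((P.τ₀ * P.ε₀ + M) * ε⁻¹ + P.ε₀ * ε⁻¹) * ((P.τ₀ * P.ε₀ + M) * ε⁻¹) ^ 2
        * ε⁻¹ ^ 2 * (P.ε₀ * ε⁻¹) ^ 3 :=
      le_mul_of_one_le_right (by positivity) (one_le_pow₀ h3)
    _ = _ := by ring

end ExactPenalty

open ExactPenalty in
theorem mainTheorem1 {n m : ℕ} (f : EuclideanSpace ℝ (Fin n) → ℝ)
    (c : EuclideanSpace ℝ (Fin n) → EuclideanSpace ℝ (Fin m))
    (hf : ContDiff ℝ 1 f) (hc : ContDiff ℝ 1 c)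
    (flow : ℝ) (hflow : ∀ x, flow ≤ f x)
    (P : Params) (x₀ : EuclideanSpace ℝ (Fin n))
    (κm₁ κm₂ : ℝ) (hκm₁ : 0 < κm₁) (hκm₂ : 0 < κm₂) :
    -- first case: termination and explicit bound
    (∀ ε : ℝ, 0 < ε → ε ≤ P.ε₀ → ∀ R : Trace n, IsRun P f c x₀ R →
      ModelAccuracy f c R κm₁ κm₂ →
      ∀ τbar : ℝ, 0 ≤ τbar → (∀ k, τbar ≤ R.τ k → √(theta c (R.x (k + 1) 0)) < ε) →
        TerminatesAtCritical f c R ε ∧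
        ∀ K, IsFeasIndex c R ε K ∨ IsStopIndex c R ε K →
          (R.totalInner f c K : ℝ) ≤ complexityBound P f c flow κm₁ κm₂ R τbar ε K) ∧
    -- first case: order of the bound
    (∀ Λ : ℝ, ∃ C : ℝ, 0 < C ∧
      ∀ ε : ℝ, 0 < ε → ε ≤ P.ε₀ → ∀ R : Trace n, IsRun P f c x₀ R →
      ModelAccuracy f c R κm₁ κm₂ → (∀ k, R.τ (k + 1) ≤ Λ * R.τ k) →
      ∀ τbar : ℝ, P.τ₀ ≤ τbar → (∀ k, τbar ≤ R.τ k → √(theta c (R.x (k + 1) 0)) < ε) →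
        ∀ K, IsFeasIndex c R ε K ∨ IsStopIndex c R ε K →
          (R.totalInner f c K : ℝ)
            ≤ C * ((τbar + |Real.log (ε / P.ε₀)|) * τbar ^ 2 * ε⁻¹ ^ 2)) ∧
    -- second case: termination, and explicit bound for all sufficiently small `ε`
    (∀ κg : ℝ, 0 ≤ κg → ∃ εbar : ℝ, 0 < εbar ∧
      ∀ ε : ℝ, 0 < ε → ε ≤ P.ε₀ → ∀ R : Trace n, IsRun P f c x₀ R →
      ModelAccuracy f c R κm₁ κm₂ → (∀ k, ‖gradient f (R.x k 0)‖ ≤ κg) →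
        TerminatesAtCritical f c R ε ∧
        (ε ≤ εbar → ∀ K, IsFeasIndex c R ε K ∨ IsStopIndex c R ε K →
          (R.totalInner f c K : ℝ)
            ≤ complexityBound P f c flow κm₁ κm₂ R ((κg + 1) * ε⁻¹ ^ 2 + 1) ε K)) ∧
    -- second case: order of the bound
    (∀ κg : ℝ, 0 ≤ κg → ∀ Λ : ℝ, ∃ C : ℝ, 0 < C ∧
      ∀ ε : ℝ, 0 < ε → ε ≤ P.ε₀ → ∀ R : Trace n, IsRun P f c x₀ R →
      ModelAccuracy f c R κm₁ κm₂ → (∀ k, R.τ (k + 1) ≤ Λ * R.τ k) →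
      (∀ k, ‖gradient f (R.x k 0)‖ ≤ κg) →
        ∀ K, IsFeasIndex c R ε K ∨ IsStopIndex c R ε K →
          (R.totalInner f c K : ℝ) ≤ C * ε⁻¹ ^ 8) := by
  refine ⟨?_, ?_, ?_, ?_⟩
  · intro ε hε hε₀ R hR hacc τbar hτbar hθ
    have hinc : IncreasesBelow P c R ε τbar := increasesBelow_of_theta_lt hθ
    exact ⟨hR.terminatesAtCritical hacc hflow hε hε₀ hinc, fun K hK =>
      hR.totalInner_le_complexityBound hacc hflow hε hε₀ hτbar hinc
        fun l hl => not_stopsAt_of_lt hK hl⟩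
  · intro Λ
    obtain ⟨C, hC, h⟩ := exists_totalInner_le_order P f c x₀ hflow κm₁ κm₂ Λ
    exact ⟨C, hC, fun ε hε hε₀ R hR hacc hΛ τbar hτbar hθ =>
      h ε hε hε₀ R hR hacc hΛ τbar hτbar (increasesBelow_of_theta_lt hθ)⟩
  · intro κg hκg
    have hβ₂ := P.β₂_pos
    have hβ₄ := P.β₄_pos
    have hε0 := P.ε₀_pos
    set M := P.ε₀ / P.β₄ + κg + P.ε₀ with hMdef
    have hM : 0 < M := by positivity
    -- This `εbar` is where `M / (β₂ ε)` and `(κg + 1) ε⁻²` coincide.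
    refine ⟨(κg + 1) * P.β₂ / M, by positivity, fun ε hε hε₀ R hR hacc hg => ?_⟩
    have hinc := hR.increasesBelow_of_gradient_le hacc hflow hε hg
    refine ⟨hR.terminatesAtCritical hacc hflow hε hε₀ hinc, fun hεbar K hK =>
      hR.totalInner_le_complexityBound hacc hflow hε hε₀ (by positivity) (hinc.mono ?_)
        fun l hl => not_stopsAt_of_lt hK hl⟩
    rw [← hMdef]
    rw [le_div_iff₀ hM] at hεbar
    have h1 : M / (P.β₂ * ε) ≤ (κg + 1) * ε⁻¹ ^ 2 := by
      rw [inv_pow, ← div_eq_mul_inv, div_le_div_iff₀ (by positivity) (by positivity)]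
      have := mul_le_mul_of_nonneg_right hεbar hε.le
      linarith
    linarith
  · intro κg hκg Λ
    obtain ⟨C, hC, h⟩ := exists_totalInner_le_order P f c x₀ hflow κm₁ κm₂ Λ
    have hβ₂ := P.β₂_pos
    have hβ₄ := P.β₄_pos
    have hε0 := P.ε₀_pos
    have hτ₀ := P.τ₀_pos
    set M := (P.ε₀ / P.β₄ + κg + P.ε₀) / P.β₂ with hMdef
    have hM : 0 < M := by positivity
    refine ⟨C * ((P.τ₀ * P.ε₀ + M + P.ε₀) * (P.τ₀ * P.ε₀ + M) ^ 2 * P.ε₀ ^ 3), by positivity,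
      fun ε hε hε₀ R hR hacc hΛ hg K hK => ?_⟩
    have hinc := hR.increasesBelow_of_gradient_le hacc hflow hε hg
    rw [← div_div, ← hMdef] at hinc
    -- The threshold is raised to at least `τ₀`, as the order estimate requires.
    refine (h ε hε hε₀ R hR hacc hΛ _ (le_max_left _ (M / ε))
      (hinc.mono (le_max_right _ _)) K hK).trans ?_
    rw [mul_assoc C]
    exact mul_le_mul_of_nonneg_left (order_le_of_gradient_bound P hM hε hε₀) hC.le
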